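/- Let $b$ be a prime, let $m,s,d\ge 1$ be integers, and let $\boldsymbol u=(u_j)_{j\ge 1}$ be a sequence of real weights with $u_1\ge u_2\ge\cdots>0$. Identify $\mathbb Z_b=\mathbb Z/b\mathbb Z$ with $\{0,\dots,b-1\}$. Function space and worst-case error. For $f\in C^\infty([0,1]^s)$ (real-valued) put $$\|f\|_{s,\boldsymbol u}=\sup_{\boldsymbol\alpha\in\mathbb N_0^s}\frac{\|f^{(\alpha_1,\dots,\alpha_s)}\|_{L^1([0,1]^s)}}{\prod_{j=1}^s u_j^{\alpha_j}},\qquad \mathcal F_{s,\boldsymbol u}=\{f\in C^\infty([0,1]^s):\|f\|_{s,\boldsymbol u}<\infty\},$$ where $f^{(\alpha_1,\dots,\alpha_s)}=(\partial/\partial x_1)^{\alpha_1}\cdots(\partial/\partial x_s)^{\alpha_s}f$. For a finite point set $P\subset[0,1]^s$, counted with multiplicity, put $$e^{\mathrm{wor}}(\mathcal F_{s,\boldsymbol u};P)=\sup_{f\in\mathcal F_{s,\boldsymbol u},\ \|f\|_{s,\boldsymbol u}\le 1}\Bigl|\frac1{|P|}\sum_{\boldsymbol x\in P}f(\boldsymbol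 x)-\int_{[0,1]^s}f(\boldsymbol x)\,d\boldsymbol x\Bigr|.$$ Point set. Let $p\in\mathbb Z_b[x]$ with $\deg p=m$ and $\boldsymbol q=(q_1,\dots,q_{ds})\in(\mathbb Z_b[x])^{ds}$. Define $v_m:\mathbb Z_b((x^{-1}))\to[0,1)$ by $v_m(\sum_{l\ge w}t_lx^{-l})=\sum_{l=\max(1,w)}^m t_lb^{-l}$, and identify an integer $n=\sum_i\nu_ib^i\ge0$ (in base $b$) with the polynomial $n(x)=\sum_i\nu_ix^i$. The polynomial lattice point set $P(\boldsymbol q,p)$ consists of the $b^m$ points $\boldsymbol x_n=(v_m(n(x)q_j(x)/p(x)))_{1\le j\le ds}\in[0,1)^{ds}$, $0\le n<b^m$. For $(z_1,\dots,z_d)\in[0,1)^d$ with $b$-adic expansions $z_h=\sum_{i\ge1}\xi_{i,h}b^{-i}$ (infinitely many digits different from $b-1$) put $\mathcal D_d(z_1,\dots,z_d)=\sum_{i\ge1}\sum_{h=1}^d\xi_{i,h}b^{-d(i-1)-h}$; apply $\mathcal D_d$ to a vector in $[0,1)^{ds}$ by applying it to each of the $s$ consecutive blocks of $d$ components. The interlaced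 polynomial lattice point set of order $d$ is $\mathcal D_d(P(\boldsymbol q,p))=\{\mathcal D_d(\boldsymbol x_n):0\le n<b^m\}\subset[0,1)^s$. Dual polynomial lattice. For $k=\sum_i\kappa_ib^i\in\mathbb N_0$ let $\mathrm{tr}_m(k)=\sum_{i=0}^{m-1}\kappa_ix^i\in\mathbb Z_b[x]$, and let $$P^\perp(\boldsymbol q,p)=\Bigl\{\boldsymbol k\in\mathbb N_0^{ds}:\ p \text{ divides } \sum_{j=1}^{ds}\mathrm{tr}_m(k_j)\,q_j\Bigr\}.$$ Constants and exponent. Let $\omega_b=e^{2\pi\sqrt{-1}/b}$, $m_b=\min_{1\le c\le b-1}|1-\overline{\omega_b}^{\,c}|$, $M_b=\max_{1\le c\le b-1}|1-\overline{\omega_b}^{\,c}|$, $C_2=2$ and $C_b=M_b+\frac{b\,m_b}{b-M_b}$ for $b\ne2$. Put $a_j=-\log_b(C_bm_b^{-1}u_j)$ and $\boldsymbol a=(a_j)_{j\ge 1}$. For $a\in\mathbb R$, $1\le h\le d$ and $k=\kappa_1b^{c_1-1}+\dots+\kappa_vb^{c_v-1}\in\mathbb N$ with $\kappa_i\in\{1,\dots,b-1\}$,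 $c_1>\dots>c_v>0$, let $\tilde\mu(a,h;k)=\sum_{i=1}^v[d(c_i-1)+h+a]$, let $\tilde\mu(a,h;0)=0$, and for $\boldsymbol k\in\mathbb N_0^{ds}$ let $\tilde\mu(\boldsymbol a;\boldsymbol k)=\sum_{j=1}^s\sum_{h=1}^d\tilde\mu(a_j,h;k_{d(j-1)+h})$. Then the series below converges and $$e^{\mathrm{wor}}(\mathcal F_{s,\boldsymbol u};\mathcal D_d(P(\boldsymbol q,p)))\ \le\ \sum_{\boldsymbol k\in P^\perp(\boldsymbol q,p)\setminus\{\boldsymbol 0\}}b^{-\tilde\mu(\boldsymbol a;\boldsymbol k)}.$$ -/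

import Mathlib

open scoped ContDiff

noncomputable section

namespace InterlacedLattice

/-! ### The weighted space of smooth functions and the worst-case error

A weight sequence is stored as `u : ℕ → ℝ`, numbered from `0`: the weight of the first coordinate is
`u 0`, and the coordinate `j : Fin s` has the weight `u j`. -/

/-- The closed unit cube `[0,1]^s`. -/
def cube (s : ℕ) : Set (Fin s → ℝ) := Set.Icc 0 1

/-- The partial derivative in the coordinate `j` of a function on the closed cube (one-sided on the
boundary faces). -/
def partialDeriv {s : ℕ} (j : Fin s) (f : (Fin s → ℝ) → ℝ) : (Fin s → ℝ) → ℝ :=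
  fun x => fderivWithin ℝ f (cube s) x (Pi.single j 1)

/-- The mixed partial derivative `(∂/∂x_1)^{α_1} ⋯ (∂/∂x_s)^{α_s} f` on the closed cube. -/
def mixedPartial {s : ℕ} (α : Fin s → ℕ) (f : (Fin s → ℝ) → ℝ) : (Fin s → ℝ) → ℝ :=
  (List.finRange s).foldr (fun j g => (partialDeriv j)^[α j] g) f

/-- The norm `sup_α ‖f^{(α)}‖_{L^1([0,1]^s)} / ∏_j u_j^{α_j}`, with values in `[0,∞]`. -/
def weightedNorm (s : ℕ) (u : ℕ → ℝ) (f : (Fin s → ℝ) → ℝ) : ENNReal :=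
  ⨆ α : Fin s → ℕ,
    MeasureTheory.eLpNorm (mixedPartial α f) 1 (MeasureTheory.volume.restrict (cube s)) /
      ENNReal.ofReal (∏ j : Fin s, u j ^ α j)

/-- The weighted space: smooth functions on the closed unit cube with finite norm. The values of a
representative `f` outside the cube play no role. -/
def weightedSpace (s : ℕ) (u : ℕ → ℝ) : Set ((Fin s → ℝ) → ℝ) :=
  {f | ContDiffOn ℝ ∞ f (cube s) ∧ weightedNorm s u f < ⊤}

/-- The integral of `f` over the unit cube. -/
def cubeIntegral {s : ℕ} (f : (Fin s → ℝ) → ℝ) : ℝ := ∫ x in cube s, f x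

/-- The quasi-Monte Carlo rule `|P|⁻¹ ∑_{x ∈ P} f x`. The point set is an indexed family, so that
points are counted with multiplicity. -/
def qmcRule {s : ℕ} {ι : Type} [Fintype ι] (P : ι → Fin s → ℝ) (f : (Fin s → ℝ) → ℝ) : ℝ :=
  (Fintype.card ι : ℝ)⁻¹ * ∑ i, f (P i)

/-- The worst-case error of the quasi-Monte Carlo rule with point set `P` over the unit ball of the
weighted space, with values in `[0,∞]`. -/
def worstCaseError {s : ℕ} (u : ℕ → ℝ) {ι : Type} [Fintype ι] (P : ι → Fin s → ℝ) : ENNReal :=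
  ⨆ f ∈ {f | f ∈ weightedSpace s u ∧ weightedNorm s u f ≤ 1},
    ENNReal.ofReal |qmcRule P f - cubeIntegral f|

/-! ### Polynomial lattice point sets -/

/-- The coefficient `κ_i` of `b^i` in the `b`-adic expansion of `k`. -/
def natDigit (b k i : ℕ) : ℕ := k / b ^ i % b

/-- The polynomial `κ_0 + κ_1 x + ⋯` over `ℤ/b` identified with `k = κ_0 + κ_1 b + ⋯`. -/
def natPoly (b k : ℕ) : Polynomial (ZMod b) :=
  ∑ i ∈ Finset.range (Nat.log b k + 1), Polynomial.monomial i (natDigit b k i : ZMod b)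

/-- The truncated polynomial `κ_0 + κ_1 x + ⋯ + κ_{m-1} x^{m-1}` of `k`. -/
def truncPoly (b m k : ℕ) : Polynomial (ZMod b) :=
  ∑ i ∈ Finset.range m, Polynomial.monomial i (natDigit b k i : ZMod b)

/-- A polynomial in `x` as an element of the field of formal Laurent series in `x⁻¹`. That field is
`LaurentSeries (ZMod b)`, whose indeterminate stands for `x⁻¹`; hence `x` is `single (-1) 1`. -/
def toLaurent (b : ℕ) (f : Polynomial (ZMod b)) : LaurentSeries (ZMod b) :=
  Polynomial.aeval (HahnSeries.single (-1 : ℤ) (1 : ZMod b)) f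

/-- The map `v_m : ∑_l t_l x^{-l} ↦ ∑_{1 ≤ l ≤ m} t_l b^{-l}`. -/
def laurentToReal (b m : ℕ) (L : LaurentSeries (ZMod b)) : ℝ :=
  ∑ l ∈ Finset.Icc 1 m, ((L.coeff (l : ℤ)).val : ℝ) * ((b : ℝ) ^ l)⁻¹

/-- The points `x_n`, `0 ≤ n < b^m`, of the polynomial lattice point set `P(q,p)` in dimension `t`,
where `m` is the degree of `p`. -/
def latticePoint {b : ℕ} [Fact b.Prime] (m : ℕ) {t : ℕ} (p : Polynomial (ZMod b))
    (q : Fin t → Polynomial (ZMod b)) (n : Fin (b ^ m)) : Fin t → ℝ :=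
  fun j => laurentToReal b m (toLaurent b (natPoly b n) * toLaurent b (q j) / toLaurent b p)

/-- The dual polynomial lattice `{k ∈ ℕ₀^t : tr_m(k) · q ≡ 0 mod p}`. -/
def dualLattice {b : ℕ} (m : ℕ) {t : ℕ} (p : Polynomial (ZMod b))
    (q : Fin t → Polynomial (ZMod b)) : Set (Fin t → ℕ) :=
  {k | p ∣ ∑ j, truncPoly b m (k j) * q j}

/-! ### Digit interlacing

The `s * d` components of a vector are grouped into `s` consecutive blocks of length `d`: the `h`-th
component of the `j`-th block (numbered from `0`) has the index `finProdFinEquiv (j, h)`, that is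
`d * j + h`. -/

/-- The digit interlacing function on `[0,1)^d`. Here `Real.digits x b i` is the coefficient of
`b^{-(i+1)}` in the expansion of `x ∈ [0,1)` that does not end in digits `b - 1` only. -/
def interlace (b : ℕ) [NeZero b] {d : ℕ} (x : Fin d → ℝ) : ℝ :=
  ∑' i : ℕ, ∑ h : Fin d,
    ((Real.digits (x h) b i : ℕ) : ℝ) * ((b : ℝ) ^ (d * i + (h : ℕ) + 1))⁻¹

/-- Digit interlacing applied to every block of `d` consecutive components. -/
def interlaceVec (b : ℕ) [NeZero b] (s d : ℕ) (x : Fin (s * d) → ℝ) : Fin s → ℝ :=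
  fun j => interlace b (fun h : Fin d => x (finProdFinEquiv (j, h)))

/-- The points of the interlaced polynomial lattice point set of order `d`. -/
def interlacedPoint {b : ℕ} [Fact b.Prime] (m s d : ℕ) (p : Polynomial (ZMod b))
    (q : Fin (s * d) → Polynomial (ZMod b)) (n : Fin (b ^ m)) : Fin s → ℝ :=
  interlaceVec b s d (latticePoint m p q n)

/-! ### The constants and the exponent of the bound -/

/-- The root of unity `exp(2πi/b)`. -/
def omega (b : ℕ) : ℂ := Complex.exp (2 * Real.pi * Complex.I / b)

/-- `m_b`, the minimum over `1 ≤ c ≤ b - 1` of `|1 - conj(ω_b)^c|`. -/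
def minConst (b : ℕ) : ℝ := ⨅ c : Set.Icc 1 (b - 1), ‖1 - (starRingEnd ℂ (omega b)) ^ (c : ℕ)‖

/-- `M_b`, the maximum over `1 ≤ c ≤ b - 1` of `|1 - conj(ω_b)^c|`. -/
def maxConst (b : ℕ) : ℝ := ⨆ c : Set.Icc 1 (b - 1), ‖1 - (starRingEnd ℂ (omega b)) ^ (c : ℕ)‖

/-- The constant `C_b`. -/
def walshConst (b : ℕ) : ℝ :=
  if b = 2 then 2 else maxConst b + b * minConst b / (b - maxConst b)

/-- The sequence `a_j = -log_b (C_b m_b⁻¹ u_j)`. -/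
def shift (b : ℕ) (u : ℕ → ℝ) (j : ℕ) : ℝ :=
  -Real.logb b (walshConst b * (minConst b)⁻¹ * u j)

/-- `∑_i [d (c_i - 1) + h + a]`, where the `c_i - 1` are the positions of the nonzero `b`-adic digits
of `k`. -/
def muTilde₁ (b d : ℕ) (a : ℝ) (h k : ℕ) : ℝ :=
  ∑ i ∈ Finset.range (Nat.log b k + 1) with natDigit b k i ≠ 0, ((d * i + h : ℕ) + a : ℝ)

/-- `∑_{j=1}^s ∑_{h=1}^d μ̃(a_j, h; k_{d(j-1)+h})`; as `h : Fin d` starts at `0`, the second argument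
is `h + 1`. -/
def muTilde (b s d : ℕ) (a : ℕ → ℝ) (k : Fin (s * d) → ℕ) : ℝ :=
  ∑ j : Fin s, ∑ h : Fin d, muTilde₁ b d (a j) (h + 1) (k (finProdFinEquiv (j, h)))

end InterlacedLattice

end

open scoped ContDiff

noncomputable section

namespace InterlacedLattice

open MeasureTheory

/-! ### The constants -/

lemma norm_one_sub_conj_omega_pow (b : ℕ) [NeZero b] (c : ℕ) :
    ‖1 - (starRingEnd ℂ (omega b)) ^ c‖ = ‖1 - ZMod.stdAddChar (c : ZMod b)‖ := by
  have h : ZMod.stdAddChar (c : ZMod b) = omega b ^ c := by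
    have := ZMod.stdAddChar_coe (N := b) (c : ℤ)
    rw [Int.cast_natCast] at this
    rw [this, omega, ← Complex.exp_nat_mul]
    congr 1
    push_cast
    ring
  rw [h, ← Complex.norm_conj (1 - omega b ^ c)]
  simp

lemma norm_stdAddChar {b : ℕ} [NeZero b] (a : ZMod b) : ‖ZMod.stdAddChar a‖ = 1 := by
  rw [ZMod.stdAddChar_apply, Circle.norm_coe]

lemma eq_zero_or_one_of_zmod_two : ∀ a : ZMod 2, a = 0 ∨ a = 1 := by decide

section Constants

variable {b : ℕ} [hb : Fact b.Prime]

lemma nonempty_Icc_one_pred : Nonempty (Set.Icc 1 (b - 1)) :=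
  ⟨⟨1, le_rfl, by have := hb.out.two_le; omega⟩⟩

lemma stdAddChar_ne_one {a : ZMod b} (ha : a ≠ 0) : ZMod.stdAddChar a ≠ (1 : ℂ) := by
  intro h
  rw [← AddChar.map_zero_eq_one (ZMod.stdAddChar (N := b))] at h
  exact ha (ZMod.injective_stdAddChar h)

lemma val_mem_Icc {a : ZMod b} (ha : a ≠ 0) : a.val ∈ Set.Icc 1 (b - 1) := by
  have h1 := ZMod.val_lt a
  have h2 : a.val ≠ 0 := by rwa [Ne, ZMod.val_eq_zero]
  constructor <;> omega

lemma norm_one_sub_stdAddChar_le (a : ZMod b) : ‖1 - ZMod.stdAddChar a‖ ≤ maxConst b := by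
  have hbdd : BddAbove (Set.range fun c : Set.Icc 1 (b - 1) =>
      ‖1 - (starRingEnd ℂ (omega b)) ^ (c : ℕ)‖) := Set.finite_range _ |>.bddAbove
  by_cases ha : a = 0
  · obtain ⟨c⟩ := nonempty_Icc_one_pred (b := b)
    simpa [ha, maxConst] using (norm_nonneg _).trans (le_ciSup hbdd c)
  · have := le_ciSup hbdd ⟨a.val, val_mem_Icc ha⟩
    rw [norm_one_sub_conj_omega_pow] at this
    simpa [maxConst] using this

lemma minConst_le {a : ZMod b} (ha : a ≠ 0) : minConst b ≤ ‖1 - ZMod.stdAddChar a‖ := by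
  have hbdd : BddBelow (Set.range fun c : Set.Icc 1 (b - 1) =>
      ‖1 - (starRingEnd ℂ (omega b)) ^ (c : ℕ)‖) := Set.finite_range _ |>.bddBelow
  have := ciInf_le hbdd ⟨a.val, val_mem_Icc ha⟩
  rw [norm_one_sub_conj_omega_pow] at this
  simpa [minConst] using this

lemma minConst_pos : 0 < minConst b := by
  have := nonempty_Icc_one_pred (b := b)
  obtain ⟨c, hc⟩ := exists_eq_ciInf_of_finite (f := fun c : Set.Icc 1 (b - 1) =>
      ‖1 - (starRingEnd ℂ (omega b)) ^ (c : ℕ)‖)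
  rw [minConst, ← hc]
  rw [norm_one_sub_conj_omega_pow, norm_pos_iff, sub_ne_zero]
  refine (stdAddChar_ne_one fun h => ?_).symm
  rw [ZMod.natCast_eq_zero_iff] at h
  have h1 := Nat.le_of_dvd c.2.1 h
  have h2 := c.2.2
  have := hb.out.two_le
  omega

lemma norm_one_sub_stdAddChar_le_two (a : ZMod b) : ‖1 - ZMod.stdAddChar a‖ ≤ 2 := by
  refine (norm_sub_le _ _).trans ?_
  rw [norm_stdAddChar, norm_one]
  norm_num

lemma maxConst_le_two : maxConst b ≤ 2 := by
  have := nonempty_Icc_one_pred (b := b)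
  refine ciSup_le fun c => ?_
  rw [norm_one_sub_conj_omega_pow]
  exact norm_one_sub_stdAddChar_le_two _

lemma maxConst_nonneg : 0 ≤ maxConst b :=
  (norm_nonneg (1 - ZMod.stdAddChar (0 : ZMod b))).trans (norm_one_sub_stdAddChar_le _)

variable (b) in
/-- The factor `C_b m_b⁻¹` contributed by each nonzero digit to the bound on a Walsh coefficient. -/
def digitFactor : ℝ := walshConst b * (minConst b)⁻¹

lemma one_le_digitFactor_two (h2 : b = 2) : 1 ≤ digitFactor b := by
  have h0 := minConst_pos (b := b)
  have h1 : minConst b ≤ 2 :=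
    (minConst_le (one_ne_zero (α := ZMod b))).trans (norm_one_sub_stdAddChar_le_two _)
  rw [digitFactor, walshConst, if_pos h2, ← div_eq_mul_inv, le_div_iff₀ h0]
  linarith

lemma maxConst_div_minConst_add_one_le (h2 : b ≠ 2) :
    maxConst b / minConst b + 1 ≤ digitFactor b := by
  have h0 := minConst_pos (b := b)
  have h3 : (3 : ℝ) ≤ b := by
    have := hb.out.two_le
    exact_mod_cast (by omega : 3 ≤ b)
  have hM := maxConst_le_two (b := b)
  have hM0 := maxConst_nonneg (b := b)
  have hpos : 0 < (b : ℝ) - maxConst b := by linarith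
  rw [digitFactor, walshConst, if_neg h2, ← div_eq_mul_inv, le_div_iff₀ h0, add_mul,
    div_mul_cancel₀ _ h0.ne', one_mul]
  gcongr
  rw [le_div_iff₀ hpos]
  nlinarith

lemma digitFactor_pos : 0 < digitFactor b := by
  by_cases h2 : b = 2
  · linarith [one_le_digitFactor_two h2]
  · have := maxConst_div_minConst_add_one_le h2
    have := div_nonneg (maxConst_nonneg (b := b)) (minConst_pos (b := b)).le
    linarith

lemma norm_sum_stdAddChar_le {a : ZMod b} (ha : a ≠ 0) (r : ℕ) :
    ‖∑ i ∈ Finset.range r, (ZMod.stdAddChar (a * (i : ZMod b)) : ℂ)‖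
      ≤ maxConst b / minConst b := by
  have hpow : ∀ i : ℕ, (ZMod.stdAddChar (a * (i : ZMod b)) : ℂ) = ZMod.stdAddChar a ^ i := by
    intro i
    rw [mul_comm, ← nsmul_eq_mul, AddChar.map_nsmul_eq_pow]
  have h1 := stdAddChar_ne_one ha
  simp_rw [hpow]
  rw [geom_sum_eq h1, norm_div, ← hpow, norm_sub_rev, norm_sub_rev _ (1 : ℂ)]
  exact div_le_div₀ maxConst_nonneg (norm_one_sub_stdAddChar_le _) minConst_pos (minConst_le ha)

lemma sum_stdAddChar_eq_zero {a : ZMod b} (ha : a ≠ 0) :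
    ∑ i ∈ Finset.range b, (ZMod.stdAddChar (a * (i : ZMod b)) : ℂ) = 0 := by
  have hpow : ∀ i : ℕ, (ZMod.stdAddChar (a * (i : ZMod b)) : ℂ) = ZMod.stdAddChar a ^ i := by
    intro i
    rw [mul_comm, ← nsmul_eq_mul, AddChar.map_nsmul_eq_pow]
  simp_rw [hpow]
  rw [geom_sum_eq (stdAddChar_ne_one ha), ← hpow]
  simp

/-! ### Walsh functions -/

/-- The value on the interval `[l b⁻ⁿ, (l+1) b⁻ⁿ)` of the Walsh function whose frequency has the
digits `κ 0, …, κ (n-1)`, where `κ c` belongs to the digit of `b^{-(c+1)}`. -/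
def walsh (κ : ℕ → ZMod b) : ℕ → ℕ → ℂ
  | 0, _ => 1
  | n + 1, l => walsh κ n (l / b) * ZMod.stdAddChar (κ n * (l : ZMod b))

lemma norm_walsh (κ : ℕ → ZMod b) (n l : ℕ) : ‖walsh κ n l‖ = 1 := by
  induction n generalizing l with
  | zero => simp [walsh]
  | succ n ih => rw [walsh, norm_mul, ih, norm_stdAddChar, one_mul]

lemma walsh_zero_right (κ : ℕ → ZMod b) (n : ℕ) : walsh κ n 0 = 1 := by
  induction n with
  | zero => simp [walsh]
  | succ n ih => simp [walsh, ih]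

lemma walsh_succ_mul_add (κ : ℕ → ZMod b) (n l : ℕ) {r : ℕ} (hr : r < b) :
    walsh κ (n + 1) (b * l + r) = walsh κ n l * ZMod.stdAddChar (κ n * (r : ZMod b)) := by
  rw [walsh, Nat.mul_add_div hb.out.pos, Nat.div_eq_of_lt hr, add_zero]
  simp

/-- The Walsh function as a function of a real variable. -/
def walshFun (κ : ℕ → ZMod b) (N : ℕ) (x : ℝ) : ℂ := walsh κ N ⌊(b : ℝ) ^ N * x⌋₊

lemma sum_walsh_succ {κ : ℕ → ZMod b} {n : ℕ} (hκ : κ n ≠ 0) (l : ℕ) {r : ℕ} (hr : r ≤ b) :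
    ∑ i ∈ Finset.range (b * l + r), walsh κ (n + 1) i =
      walsh κ n l * ∑ i ∈ Finset.range r, ZMod.stdAddChar (κ n * (i : ZMod b)) := by
  have key : ∀ l r : ℕ, r ≤ b → ∑ i ∈ Finset.range r, walsh κ (n + 1) (b * l + i) =
      walsh κ n l * ∑ i ∈ Finset.range r, ZMod.stdAddChar (κ n * (i : ZMod b)) := by
    intro l r hr
    rw [Finset.mul_sum]
    refine Finset.sum_congr rfl fun i hi => walsh_succ_mul_add _ _ _ ?_
    exact (Finset.mem_range.1 hi).trans_le hr
  have h0 : ∀ l, ∑ i ∈ Finset.range (b * l), walsh κ (n + 1) i = 0 := by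
    intro l
    induction l with
    | zero => simp
    | succ l ih =>
      rw [mul_add, mul_one, Finset.sum_range_add, ih, key l b le_rfl, sum_stdAddChar_eq_zero hκ]
      simp
  rw [Finset.sum_range_add, h0, key l r hr, zero_add]

/-- `Φ` transforms like a Walsh function under translations by multiples of `b⁻ⁿ`. -/
def WalshEquivariant (κ : ℕ → ZMod b) (n : ℕ) (Φ : ℝ → ℂ) : Prop :=
  ∀ l : ℕ, ∀ y ∈ Set.Ico (0 : ℝ) 1, Φ ((l + y) / b ^ n) = walsh κ n l * Φ (y / b ^ n)

lemma walshEquivariant_walshFun (κ : ℕ → ZMod b) (N : ℕ) :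
    WalshEquivariant κ N (walshFun κ N) := by
  intro l y hy
  have hb0 : ((b : ℝ) ^ N) ≠ 0 := pow_ne_zero _ (by exact_mod_cast hb.out.ne_zero)
  have h0 : ⌊y⌋₊ = 0 := Nat.floor_eq_zero.2 hy.2
  rw [walshFun, walshFun, mul_div_cancel₀ _ hb0, mul_div_cancel₀ _ hb0, add_comm,
    Nat.floor_add_natCast hy.1, h0, walsh_zero_right]
  simp

/-- Every `y ∈ [0,1)` has the first digit `r` and the remainder `y' / b`. -/
lemma exists_eq_add_div {y : ℝ} (hy : y ∈ Set.Ico (0 : ℝ) 1) :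
    ∃ r < b, ∃ y' ∈ Set.Ico (0 : ℝ) 1, y = (r + y') / b := by
  have hb0 : (0 : ℝ) < b := by exact_mod_cast hb.out.pos
  have h1 : 0 ≤ (b : ℝ) * y := mul_nonneg hb0.le hy.1
  refine ⟨⌊(b : ℝ) * y⌋₊, ?_, b * y - ⌊(b : ℝ) * y⌋₊, ⟨?_, ?_⟩, ?_⟩
  · rw [Nat.floor_lt h1]
    nlinarith [hy.2]
  · linarith [Nat.floor_le h1]
  · linarith [Nat.lt_floor_add_one ((b : ℝ) * y)]
  · field_simp
    ring

lemma add_div_pow_eq (n l r : ℕ) (y : ℝ) :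
    ((l : ℝ) + (r + y) / b) / b ^ n = (((b * l + r : ℕ) : ℝ) + y) / b ^ (n + 1) := by
  have hb0 : (b : ℝ) ≠ 0 := by exact_mod_cast hb.out.ne_zero
  push_cast
  field_simp
  ring

lemma WalshEquivariant.pred {κ : ℕ → ZMod b} {n : ℕ} {Φ : ℝ → ℂ}
    (h : WalshEquivariant κ (n + 1) Φ) : WalshEquivariant κ n Φ := by
  intro l y hy
  obtain ⟨r, hr, y', hy', rfl⟩ := exists_eq_add_div (b := b) hy
  have h0 := add_div_pow_eq (b := b) n 0 r y'
  rw [Nat.cast_zero, zero_add, mul_zero, zero_add] at h0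
  have h1 : walsh κ (n + 1) r = ZMod.stdAddChar (κ n * (r : ZMod b)) := by
    have := walsh_succ_mul_add κ n 0 hr
    rwa [mul_zero, zero_add, walsh_zero_right, one_mul] at this
  rw [add_div_pow_eq, h _ _ hy', h0, h _ _ hy', walsh_succ_mul_add _ _ _ hr, h1, mul_assoc]

/-- The primitive that vanishes at `0`. -/
def primitive (Φ : ℝ → ℂ) (x : ℝ) : ℂ := ∫ t in (0 : ℝ)..x, Φ t

@[simp] lemma primitive_zero (Φ : ℝ → ℂ) : primitive Φ 0 = 0 := by simp [primitive]

section Step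

variable {κ : ℕ → ZMod b} {n : ℕ} {Φ : ℝ → ℂ}

lemma WalshEquivariant.integral_translate (h : WalshEquivariant κ n Φ) (l : ℕ) {y : ℝ}
    (hy : y ∈ Set.Icc (0 : ℝ) 1) :
    ∫ t in ((l : ℝ) / b ^ n)..((l + y) / b ^ n), Φ t =
      walsh κ n l * primitive Φ (y / b ^ n) := by
  have hb0 : (0 : ℝ) < (b : ℝ) ^ n := pow_pos (by exact_mod_cast hb.out.pos) _
  have h1 := intervalIntegral.integral_comp_add_right (a := 0) (b := y / b ^ n) Φ
    ((l : ℝ) / b ^ n)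
  rw [zero_add, ← add_div, add_comm y] at h1
  rw [← h1, primitive, ← intervalIntegral.integral_const_mul]
  have hle : 0 ≤ y / b ^ n := div_nonneg hy.1 hb0.le
  rw [intervalIntegral.integral_of_le hle, intervalIntegral.integral_of_le hle,
    integral_Ioc_eq_integral_Ioo, integral_Ioc_eq_integral_Ioo]
  refine setIntegral_congr_fun measurableSet_Ioo fun t ht => ?_
  have h2 := h l (t * b ^ n) ⟨mul_nonneg ht.1.le hb0.le, ?_⟩
  · rw [mul_div_cancel_right₀ _ hb0.ne', add_div, mul_div_cancel_right₀ _ hb0.ne'] at h2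
    rw [add_comm, h2]
  · exact ((lt_div_iff₀ hb0).1 ht.2).trans_le hy.2

lemma WalshEquivariant.primitive_eq (h : WalshEquivariant κ n Φ)
    (hint : ∀ x y, IntervalIntegrable Φ volume x y) (l : ℕ) {y : ℝ} (hy : y ∈ Set.Icc (0 : ℝ) 1) :
    primitive Φ ((l + y) / b ^ n) = primitive Φ (1 / b ^ n) * ∑ i ∈ Finset.range l, walsh κ n i +
      walsh κ n l * primitive Φ (y / b ^ n) := by
  have hl : ∀ l : ℕ, primitive Φ ((l : ℝ) / b ^ n) =
      primitive Φ (1 / b ^ n) * ∑ i ∈ Finset.range l, walsh κ n i := by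
    intro l
    induction l with
    | zero => simp
    | succ l ih =>
      have h1 := h.integral_translate l (y := 1) (by simp)
      rw [Finset.sum_range_succ, mul_add, ← ih, mul_comm _ (walsh κ n l), ← h1, primitive,
        primitive, intervalIntegral.integral_add_adjacent_intervals (hint _ _) (hint _ _)]
      push_cast
      rfl
  rw [← hl, ← h.integral_translate l hy, primitive, primitive,
    intervalIntegral.integral_add_adjacent_intervals (hint _ _) (hint _ _)]

lemma norm_integral_le_of_bound {B : ℝ} (hB : ∀ x, 0 ≤ x → ‖Φ x‖ ≤ B) {x y : ℝ} (hx : 0 ≤ x)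
    (hxy : x ≤ y) : ‖∫ t in x..y, Φ t‖ ≤ B * (y - x) := by
  have := intervalIntegral.norm_integral_le_of_norm_le_const (a := x) (b := y) (f := Φ) (C := B)
    fun t ht => hB t (by rw [Set.uIoc_of_le hxy] at ht; linarith [ht.1])
  rwa [abs_of_nonneg (by linarith)] at this

/-- The bracket in the formula for the primitive is bounded by `b^{-(n+1)} C_b m_b⁻¹ sup |Φ|`. -/
lemma norm_bracket_le (hκ : κ n ≠ 0)
    (hint : ∀ x y, IntervalIntegrable Φ volume x y) {B : ℝ} (hB : ∀ x, 0 ≤ x → ‖Φ x‖ ≤ B)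
    {r : ℕ} (hr : r < b) {y : ℝ} (hy : y ∈ Set.Icc (0 : ℝ) 1) :
    ‖primitive Φ (1 / b ^ (n + 1)) *
        ∑ i ∈ Finset.range r, ZMod.stdAddChar (κ n * (i : ZMod b)) +
      ZMod.stdAddChar (κ n * (r : ZMod b)) * primitive Φ (y / b ^ (n + 1))‖
      ≤ ((b : ℝ) ^ (n + 1))⁻¹ * digitFactor b * B := by
  have hB0 : 0 ≤ B := (norm_nonneg _).trans (hB 0 le_rfl)
  have hb0 : (0 : ℝ) < (b : ℝ) ^ (n + 1) := pow_pos (by exact_mod_cast hb.out.pos) _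
  set δ : ℝ := ((b : ℝ) ^ (n + 1))⁻¹ with hδ
  have hδ0 : 0 < δ := inv_pos.2 hb0
  rw [div_eq_mul_inv, div_eq_mul_inv, ← hδ, one_mul]
  have hyδ0 : 0 ≤ y * δ := mul_nonneg hy.1 hδ0.le
  have hyδ : y * δ ≤ δ := by nlinarith [hy.2]
  have hI : ‖primitive Φ δ‖ ≤ δ * B := by
    have := norm_integral_le_of_bound hB le_rfl hδ0.le
    rw [primitive]; linarith
  have hJ : ‖primitive Φ (y * δ)‖ ≤ δ * B := by
    have := norm_integral_le_of_bound hB le_rfl hyδ0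
    rw [primitive]; nlinarith
  by_cases h2 : b = 2
  · refine le_trans ?_ (?_ : δ * B ≤ _)
    · have hr' : r = 0 ∨ r = 1 := by omega
      rcases hr' with rfl | rfl
      · simpa using hJ
      · have hone : ∀ a : ZMod b, a ≠ 0 → (ZMod.stdAddChar a : ℂ) = -1 := by
          subst h2
          intro a ha
          have ha1 : a = 1 := (eq_zero_or_one_of_zmod_two a).resolve_left ha
          subst ha1
          have := sum_stdAddChar_eq_zero (b := 2) (a := 1) one_ne_zero
          simp [Finset.sum_range_succ] at this
          linear_combination this
        have h3 := hone _ hκ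
        have h4 : primitive Φ δ - primitive Φ (y * δ) = ∫ t in (y * δ)..δ, Φ t := by
          rw [primitive, primitive, intervalIntegral.integral_interval_sub_left (hint _ _)
            (hint _ _)]
        simp only [Finset.sum_range_one, Nat.cast_zero, mul_zero, AddChar.map_zero_eq_one, mul_one,
          Nat.cast_one, h3]
        rw [neg_one_mul, ← sub_eq_add_neg, h4]
        refine (norm_integral_le_of_bound hB hyδ0 hyδ).trans ?_
        nlinarith
    · have := one_le_digitFactor_two h2
      have h5 : 0 ≤ δ * B := by positivity
      nlinarith
  · calc _ ≤ ‖primitive Φ δ‖ * ‖∑ i ∈ Finset.range r, ZMod.stdAddChar (κ n * (i : ZMod b))‖ +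
          ‖primitive Φ (y * δ)‖ := by
          refine (norm_add_le _ _).trans ?_
          rw [norm_mul, norm_mul, norm_stdAddChar, one_mul]
      _ ≤ (δ * B) * (maxConst b / minConst b) + δ * B := by
          gcongr
          exact norm_sum_stdAddChar_le hκ r
      _ = δ * B * (maxConst b / minConst b + 1) := by ring
      _ ≤ δ * B * digitFactor b := by
          gcongr
          exact maxConst_div_minConst_add_one_le h2
      _ = _ := by ring

/-- Integration over a nonzero digit lowers the level of equivariance and gains a factor. -/
lemma WalshEquivariant.primitive (h : WalshEquivariant κ (n + 1) Φ) (hκ : κ n ≠ 0)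
    (hint : ∀ x y, IntervalIntegrable Φ volume x y) {B : ℝ} (hB : ∀ x, 0 ≤ x → ‖Φ x‖ ≤ B) :
    WalshEquivariant κ n (primitive Φ) ∧
      ∀ x, 0 ≤ x → ‖InterlacedLattice.primitive Φ x‖
        ≤ ((b : ℝ) ^ (n + 1))⁻¹ * digitFactor b * B := by
  have key : ∀ l r : ℕ, r < b → ∀ y ∈ Set.Ico (0 : ℝ) 1,
      InterlacedLattice.primitive Φ ((l + (r + y) / b) / b ^ n) =
      walsh κ n l * (InterlacedLattice.primitive Φ (1 / b ^ (n + 1)) *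
        ∑ i ∈ Finset.range r, ZMod.stdAddChar (κ n * (i : ZMod b)) +
      ZMod.stdAddChar (κ n * (r : ZMod b)) *
        InterlacedLattice.primitive Φ (y / b ^ (n + 1))) := by
    intro l r hr y hy
    rw [add_div_pow_eq, h.primitive_eq hint _ ⟨hy.1, hy.2.le⟩, sum_walsh_succ hκ l hr.le,
      walsh_succ_mul_add κ n l hr]
    ring
  have hb0 : (0 : ℝ) < (b : ℝ) ^ n := pow_pos (by exact_mod_cast hb.out.pos) _
  constructor
  · intro l y hy
    obtain ⟨r, hr, y', hy', rfl⟩ := exists_eq_add_div (b := b) hy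
    have h0 := key 0 r hr y' hy'
    rw [Nat.cast_zero, zero_add, walsh_zero_right, one_mul] at h0
    rw [key l r hr y' hy', h0]
  · intro x hx
    have hx' : 0 ≤ x * b ^ n := mul_nonneg hx hb0.le
    obtain ⟨r, hr, y', hy', hy⟩ := exists_eq_add_div (b := b)
      (y := x * b ^ n - ⌊x * b ^ n⌋₊)
      ⟨by linarith [Nat.floor_le hx'], by linarith [Nat.lt_floor_add_one (x * b ^ n)]⟩
    have hxe : x = (⌊x * b ^ n⌋₊ + (r + y') / b) / b ^ n := by
      rw [← hy, add_sub_cancel, mul_div_cancel_right₀ _ hb0.ne']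
    rw [hxe, key _ r hr y' hy', norm_mul, norm_walsh, one_mul]
    exact norm_bracket_le hκ hint hB hr ⟨hy'.1, hy'.2.le⟩

lemma WalshEquivariant.apply_one (h : WalshEquivariant κ n Φ) (h0 : Φ 0 = 0) : Φ 1 = 0 := by
  have hb0 : (0 : ℝ) < (b : ℝ) ^ n := pow_pos (by exact_mod_cast hb.out.pos) _
  have := h (b ^ n) 0 (by simp)
  rw [zero_div, h0, mul_zero, add_zero] at this
  push_cast at this
  rwa [div_self hb0.ne'] at this

end Step

/-- Right-continuous, measurable and locally integrable functions, bounded on `[0,1]`. -/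
structure RightRegular (Φ : ℝ → ℂ) : Prop where
  measurable : Measurable Φ
  intervalIntegrable : ∀ x y, IntervalIntegrable Φ volume x y
  continuousWithinAt : ∀ x, ContinuousWithinAt Φ (Set.Ioi x) x
  bounded : ∃ B, ∀ x ∈ Set.Icc (0 : ℝ) 1, ‖Φ x‖ ≤ B

lemma RightRegular.continuous_primitive {Φ : ℝ → ℂ} (h : RightRegular Φ) :
    Continuous (primitive Φ) :=
  intervalIntegral.continuous_primitive h.intervalIntegrable 0

lemma RightRegular.of_continuous {Φ : ℝ → ℂ} (h : Continuous Φ) : RightRegular Φ :=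
  ⟨h.measurable, fun _ _ => h.intervalIntegrable _ _, fun _ => h.continuousWithinAt,
    isCompact_Icc.exists_bound_of_continuousOn h.continuousOn⟩

lemma RightRegular.iterate {Φ : ℝ → ℂ} (h : RightRegular Φ) (v : ℕ) :
    RightRegular (primitive^[v] Φ) := by
  induction v with
  | zero => exact h
  | succ v ih =>
    rw [Function.iterate_succ_apply']
    exact .of_continuous ih.continuous_primitive

lemma RightRegular.hasDerivWithinAt {Φ : ℝ → ℂ} (h : RightRegular Φ) (x : ℝ) :
    HasDerivWithinAt (primitive Φ) (Φ x) (Set.Ioi x) x := by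
  have := intervalIntegral.integral_hasDerivWithinAt_right (h.intervalIntegrable 0 x)
    (s := Set.Ici x) (t := Set.Ioi x) h.measurable.stronglyMeasurable.stronglyMeasurableAtFilter
    (h.continuousWithinAt x)
  exact this.mono Set.Ioi_subset_Ici_self

lemma rightRegular_walshFun (κ : ℕ → ZMod b) (N : ℕ) : RightRegular (walshFun κ N) := by
  have hb0 : (0 : ℝ) < (b : ℝ) ^ N := pow_pos (by exact_mod_cast hb.out.pos) _
  have hm : Measurable (walshFun κ N) :=
    (measurable_from_nat (f := walsh κ N)).comp
      (Nat.measurable_floor.comp (measurable_const.mul measurable_id))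
  refine ⟨hm, fun x y => ?_, fun x => ?_, 1, fun x _ => by simp [walshFun, norm_walsh]⟩
  · refine (intervalIntegrable_const (c := (1 : ℝ))).mono_fun hm.aestronglyMeasurable ?_
    exact Filter.Eventually.of_forall fun t => by simp [walshFun, norm_walsh]
  · have h1 : ∀ᶠ y in nhdsWithin x (Set.Ioi x), walshFun κ N y = walshFun κ N x := by
      have h2 : Set.Ioo x ((⌊(b : ℝ) ^ N * x⌋ + 1) / b ^ N) ∈ nhdsWithin x (Set.Ioi x) := by
        refine Ioo_mem_nhdsGT ?_
        rw [lt_div_iff₀ hb0, mul_comm]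
        exact Int.lt_floor_add_one _
      filter_upwards [h2] with y hy
      have h3 : ⌊(b : ℝ) ^ N * y⌋ = ⌊(b : ℝ) ^ N * x⌋ := by
        rw [Int.floor_eq_iff]
        refine ⟨(Int.floor_le _).trans ?_, ?_⟩
        · have := hy.1; gcongr
        · have := (lt_div_iff₀ hb0).1 hy.2
          linarith
      rw [walshFun, walshFun, ← Int.floor_toNat, h3, Int.floor_toNat]
    exact (Filter.EventuallyEq.tendsto h1 : _)

/-- The iterated primitives of a Walsh function with `v` nonzero digits. -/
lemma walshFun_iterate_primitive (κ : ℕ → ZMod b) (N : ℕ) {n : ℕ} (hn : n ≤ N) :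
    WalshEquivariant κ n
        (primitive^[((Finset.Ico n N).filter fun c => κ c ≠ 0).card] (walshFun κ N)) ∧
      (∀ x, 0 ≤ x →
        ‖primitive^[((Finset.Ico n N).filter fun c => κ c ≠ 0).card] (walshFun κ N) x‖ ≤
          ∏ c ∈ (Finset.Ico n N).filter fun c => κ c ≠ 0, ((b : ℝ) ^ (c + 1))⁻¹ * digitFactor b) ∧
      ∀ i < ((Finset.Ico n N).filter fun c => κ c ≠ 0).card,
        primitive (primitive^[i] (walshFun κ N)) 1 = 0 := by
  induction hn using Nat.decreasingInduction with
  | self =>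
    refine ⟨?_, ?_, ?_⟩
    · simpa using walshEquivariant_walshFun κ N
    · simp [walshFun, norm_walsh]
    · simp
  | of_succ n hn ih =>
    obtain ⟨h1, h2, h3⟩ := ih
    have hI : Finset.Ico n N = insert n (Finset.Ico (n + 1) N) :=
      (Finset.insert_Ico_add_one_left_eq_Ico hn).symm
    by_cases hκ : κ n = 0
    · have hf : (Finset.Ico n N).filter (fun c => κ c ≠ 0) =
          (Finset.Ico (n + 1) N).filter fun c => κ c ≠ 0 := by
        rw [hI, Finset.filter_insert, if_neg (by simpa using hκ)]
      rw [hf]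
      exact ⟨h1.pred, h2, h3⟩
    · have hmem : n ∉ (Finset.Ico (n + 1) N).filter fun c => κ c ≠ 0 := by simp
      have hf : (Finset.Ico n N).filter (fun c => κ c ≠ 0) =
          insert n ((Finset.Ico (n + 1) N).filter fun c => κ c ≠ 0) := by
        rw [hI, Finset.filter_insert, if_pos hκ]
      rw [hf, Finset.card_insert_of_notMem hmem, Finset.prod_insert hmem]
      have hR := (rightRegular_walshFun κ N).iterate
        ((Finset.Ico (n + 1) N).filter fun c => κ c ≠ 0).card
      obtain ⟨h4, h5⟩ := h1.primitive hκ hR.intervalIntegrable h2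
      rw [Function.iterate_succ_apply']
      refine ⟨h4, h5, fun i hi => ?_⟩
      rcases Nat.lt_succ_iff_lt_or_eq.1 hi with hi | rfl
      · exact h3 i hi
      · exact h4.apply_one (by simp)

end Constants

section

/-! ### Integration by parts on the cube -/

lemma mem_cube {s : ℕ} {x : Fin s → ℝ} : x ∈ cube s ↔ ∀ j, x j ∈ Set.Icc (0 : ℝ) 1 := by
  simp only [cube, Set.mem_Icc, Pi.le_def, Pi.zero_apply, Pi.one_apply, forall_and]

lemma cube_eq_pi (s : ℕ) : cube s = Set.univ.pi fun _ => Set.Icc (0 : ℝ) 1 := by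
  ext x
  simp only [mem_cube, Set.mem_univ_pi]

lemma isCompact_cube (s : ℕ) : IsCompact (cube s) := isCompact_Icc

lemma measurableSet_cube (s : ℕ) : MeasurableSet (cube s) := measurableSet_Icc

lemma uniqueDiffOn_cube (s : ℕ) : UniqueDiffOn ℝ (cube s) := by
  rw [cube_eq_pi]
  exact UniqueDiffOn.univ_pi fun _ => uniqueDiffOn_Icc zero_lt_one

lemma contDiffOn_partialDeriv {s : ℕ} (j : Fin s) {g : (Fin s → ℝ) → ℝ}
    (hg : ContDiffOn ℝ ∞ g (cube s)) : ContDiffOn ℝ ∞ (partialDeriv j g) (cube s) :=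
  (hg.fderivWithin (uniqueDiffOn_cube s) (by simp)).clm_apply contDiffOn_const

lemma contDiffOn_iterate_partialDeriv {s : ℕ} (j : Fin s) {g : (Fin s → ℝ) → ℝ}
    (hg : ContDiffOn ℝ ∞ g (cube s)) (v : ℕ) :
    ContDiffOn ℝ ∞ ((partialDeriv j)^[v] g) (cube s) := by
  induction v with
  | zero => exact hg
  | succ v ih =>
    rw [Function.iterate_succ_apply']
    exact contDiffOn_partialDeriv j ih

lemma contDiffOn_foldr_partialDeriv {s : ℕ} (α : Fin s → ℕ) {g : (Fin s → ℝ) → ℝ}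
    (hg : ContDiffOn ℝ ∞ g (cube s)) (l : List (Fin s)) :
    ContDiffOn ℝ ∞ (l.foldr (fun j g => (partialDeriv j)^[α j] g) g) (cube s) := by
  induction l with
  | nil => exact hg
  | cons j l ih => exact contDiffOn_iterate_partialDeriv j ih _

lemma integrableOn_mul_prod {s : ℕ} {g : (Fin s → ℝ) → ℝ} (hg : ContinuousOn g (cube s))
    {φ : Fin s → ℝ → ℂ} (hφ : ∀ i, RightRegular (φ i)) :
    IntegrableOn (fun x => (g x : ℂ) * ∏ i, φ i (x i)) (cube s) := by
  choose B hB using fun i => (hφ i).bounded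
  have h1 : IntegrableOn (fun x => (g x : ℂ)) (cube s) :=
    (Complex.continuous_ofReal.comp_continuousOn hg).integrableOn_compact (isCompact_cube s)
  have hm : Measurable fun x : Fin s → ℝ => ∏ i, φ i (x i) :=
    Finset.measurable_prod _ fun i _ => (hφ i).measurable.comp (measurable_pi_apply i)
  refine Integrable.mul_bdd (c := ∏ i, B i) h1 hm.aestronglyMeasurable ?_
  filter_upwards [ae_restrict_mem (measurableSet_cube s)] with x hx
  rw [norm_prod]
  exact Finset.prod_le_prod (fun _ _ => norm_nonneg _) fun i _ => hB i _ (mem_cube.1 hx i)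

lemma insertNth_mem_cube {n : ℕ} (j : Fin (n + 1)) {t : ℝ} {y : Fin n → ℝ} :
    j.insertNth t y ∈ cube (n + 1) ↔ t ∈ Set.Icc (0 : ℝ) 1 ∧ y ∈ cube n := by
  simp only [mem_cube, j.forall_iff_succAbove, Fin.insertNth_apply_same,
    Fin.insertNth_apply_succAbove]

lemma setIntegral_cube_insertNth {n : ℕ} (j : Fin (n + 1)) {F : (Fin (n + 1) → ℝ) → ℂ}
    (hF : IntegrableOn F (cube (n + 1))) :
    ∫ x in cube (n + 1), F x =
      ∫ y in cube n, ∫ t in (0 : ℝ)..1, F (j.insertNth t y) := by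
  set e : ℝ × (Fin n → ℝ) ≃ᵐ (Fin (n + 1) → ℝ) :=
    (MeasurableEquiv.piFinSuccAbove (fun _ => ℝ) j).symm
  have hem : MeasurePreserving e :=
    (volume_preserving_piFinSuccAbove (fun _ : Fin (n + 1) => ℝ) j).symm _
  have he : ∀ z, e z = j.insertNth z.1 z.2 := fun z => rfl
  have hpre : e ⁻¹' cube (n + 1) = Set.Icc 0 1 ×ˢ cube n := by
    ext z
    rw [Set.mem_preimage, he, insertNth_mem_cube, Set.mem_prod]
  have hF' : IntegrableOn (fun z => F (e z)) (e ⁻¹' cube (n + 1)) :=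
    (hem.integrableOn_comp_preimage e.measurableEmbedding).2 hF
  rw [← hem.setIntegral_preimage_emb e.measurableEmbedding, hpre]
  rw [hpre] at hF'
  rw [IntegrableOn, Measure.volume_eq_prod, ← Measure.prod_restrict] at hF'
  rw [Measure.volume_eq_prod, ← Measure.prod_restrict, integral_prod_symm _ hF']
  refine integral_congr_ae (Filter.Eventually.of_forall fun y => ?_)
  dsimp only
  rw [intervalIntegral.integral_of_le zero_le_one, integral_Icc_eq_integral_Ioc]
  rfl

lemma hasDerivWithinAt_insertNth {n : ℕ} (j : Fin (n + 1)) {g : (Fin (n + 1) → ℝ) → ℝ}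
    (hg : ContDiffOn ℝ ∞ g (cube (n + 1))) {y : Fin n → ℝ} (hy : y ∈ cube n) {t : ℝ}
    (ht : t ∈ Set.Icc (0 : ℝ) 1) :
    HasDerivWithinAt (fun t => g (j.insertNth t y)) (partialDeriv j g (j.insertNth t y))
      (Set.Icc 0 1) t := by
  have h1 : HasFDerivWithinAt g (fderivWithin ℝ g (cube (n + 1)) (j.insertNth t y))
      (cube (n + 1)) (j.insertNth t y) :=
    ((hg.differentiableOn (by simp)) _ ((insertNth_mem_cube j).2 ⟨ht, hy⟩)).hasFDerivWithinAt
  have h2 : HasDerivWithinAt (fun t : ℝ => (j.insertNth t y : Fin (n + 1) → ℝ))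
      (Pi.single j 1) (Set.Icc 0 1) t := by
    rw [hasDerivWithinAt_pi, j.forall_iff_succAbove]
    constructor
    · simpa using (hasDerivAt_id' t).hasDerivWithinAt
    · intro i
      simpa using hasDerivWithinAt_const t _ (y i)
  exact h1.comp_hasDerivWithinAt t h2 fun t' ht' => (insertNth_mem_cube j).2 ⟨ht', hy⟩

lemma continuousOn_insertNth {n : ℕ} (j : Fin (n + 1)) {g : (Fin (n + 1) → ℝ) → ℝ}
    (hg : ContinuousOn g (cube (n + 1))) {y : Fin n → ℝ} (hy : y ∈ cube n) :
    ContinuousOn (fun t => ((g (j.insertNth t y) : ℝ) : ℂ)) (Set.uIcc 0 1) := by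
  refine Complex.continuous_ofReal.comp_continuousOn (hg.comp ?_ fun t ht => ?_)
  · have h : Continuous fun t : ℝ => (j.insertNth t y : Fin (n + 1) → ℝ) :=
      Continuous.finInsertNth (A := fun _ => ℝ) j continuous_id continuous_const
    exact h.continuousOn
  · rw [Set.uIcc_of_le zero_le_one] at ht
    exact (insertNth_mem_cube j).2 ⟨ht, hy⟩

lemma integral_insertNth_by_parts {n : ℕ} (j : Fin (n + 1)) {g : (Fin (n + 1) → ℝ) → ℝ}
    (hg : ContDiffOn ℝ ∞ g (cube (n + 1))) {y : Fin n → ℝ} (hy : y ∈ cube n) {Φ : ℝ → ℂ}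
    (hΦ : RightRegular Φ) (h1 : primitive Φ 1 = 0) :
    ∫ t in (0 : ℝ)..1, (g (j.insertNth t y) : ℂ) * Φ t =
      -∫ t in (0 : ℝ)..1, (partialDeriv j g (j.insertNth t y) : ℂ) * primitive Φ t := by
  have h := intervalIntegral.integral_mul_deriv_eq_deriv_mul_of_hasDeriv_right
    (a := 0) (b := 1) (u := fun t => (g (j.insertNth t y) : ℂ)) (v := primitive Φ)
    (u' := fun t => (partialDeriv j g (j.insertNth t y) : ℂ)) (v' := Φ)
    (continuousOn_insertNth j hg.continuousOn hy) hΦ.continuous_primitive.continuousOn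
    (fun t ht => ?_) (fun t _ => hΦ.hasDerivWithinAt t)
    (continuousOn_insertNth j (contDiffOn_partialDeriv j hg).continuousOn hy).intervalIntegrable
    (hΦ.intervalIntegrable 0 1)
  · rw [h, h1, primitive_zero]
    simp
  · simp only [min_eq_left zero_le_one (α := ℝ), max_eq_right zero_le_one (α := ℝ)] at ht
    have h2 := (hasDerivWithinAt_insertNth j hg hy ⟨ht.1.le, ht.2.le⟩).hasDerivAt
      (Icc_mem_nhds ht.1 ht.2)
    exact h2.ofReal_comp.hasDerivWithinAt

lemma setIntegral_by_parts {s : ℕ} (j : Fin s) {g : (Fin s → ℝ) → ℝ}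
    (hg : ContDiffOn ℝ ∞ g (cube s)) {φ : Fin s → ℝ → ℂ} (hφ : ∀ i, RightRegular (φ i))
    (h1 : primitive (φ j) 1 = 0) :
    ∫ x in cube s, (g x : ℂ) * ∏ i, φ i (x i) =
      -∫ x in cube s, (partialDeriv j g x : ℂ) *
        ∏ i, Function.update φ j (primitive (φ j)) i (x i) := by
  obtain _ | n := s
  · exact j.elim0
  have hφ' : ∀ i, RightRegular (Function.update φ j (primitive (φ j)) i) := by
    intro i
    by_cases hi : i = j
    · subst hi
      simpa using RightRegular.of_continuous (hφ i).continuous_primitive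
    · simpa [hi] using hφ i
  rw [setIntegral_cube_insertNth j (integrableOn_mul_prod hg.continuousOn hφ),
    setIntegral_cube_insertNth j
      (integrableOn_mul_prod (contDiffOn_partialDeriv j hg).continuousOn hφ'), ← integral_neg]
  refine setIntegral_congr_fun (measurableSet_cube n) fun y hy => ?_
  have key := congrArg (· * ∏ i, φ (j.succAbove i) (y i))
    (integral_insertNth_by_parts j hg hy (hφ j) h1)
  simp only [neg_mul, ← intervalIntegral.integral_mul_const] at key
  simpa [j.prod_univ_succAbove, mul_assoc] using key

lemma norm_setIntegral_iterate_by_parts {s : ℕ} (j : Fin s) {g : (Fin s → ℝ) → ℝ}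
    (hg : ContDiffOn ℝ ∞ g (cube s)) {φ : Fin s → ℝ → ℂ} (hφ : ∀ i, RightRegular (φ i)) (v : ℕ)
    (h1 : ∀ i < v, primitive (primitive^[i] (φ j)) 1 = 0) :
    ‖∫ x in cube s, (g x : ℂ) * ∏ i, φ i (x i)‖ =
      ‖∫ x in cube s, (((partialDeriv j)^[v] g) x : ℂ) *
        ∏ i, Function.update φ j (primitive^[v] (φ j)) i (x i)‖ := by
  induction v with
  | zero => simp
  | succ v ih =>
    rw [ih fun i hi => h1 i (hi.trans (Nat.lt_succ_self v)), setIntegral_by_parts j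
      (contDiffOn_iterate_partialDeriv j hg v) (fun i => ?_) (by simpa using h1 v v.lt_succ_self),
      norm_neg]
    · simp only [Function.update_self, Function.update_idem, Function.iterate_succ_apply']
    · by_cases hi : i = j
      · subst hi
        simpa using (hφ i).iterate v
      · simpa [hi] using hφ i

lemma norm_setIntegral_foldr_by_parts {s : ℕ} {g : (Fin s → ℝ) → ℝ}
    (hg : ContDiffOn ℝ ∞ g (cube s)) {φ : Fin s → ℝ → ℂ} (hφ : ∀ i, RightRegular (φ i))
    (α : Fin s → ℕ) (h1 : ∀ j, ∀ i < α j, primitive (primitive^[i] (φ j)) 1 = 0)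
    {l : List (Fin s)} (hl : l.Nodup) :
    ‖∫ x in cube s, (g x : ℂ) * ∏ i, φ i (x i)‖ =
      ‖∫ x in cube s, (l.foldr (fun j g => (partialDeriv j)^[α j] g) g x : ℂ) *
        ∏ i, (if i ∈ l then primitive^[α i] (φ i) else φ i) (x i)‖ := by
  induction l with
  | nil => simp
  | cons j l ih =>
    obtain ⟨hj, hl⟩ := List.nodup_cons.1 hl
    rw [ih hl, norm_setIntegral_iterate_by_parts j (contDiffOn_foldr_partialDeriv α hg l)
      (fun i => ?_) (α j) (by simpa [hj] using h1 j)]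
    · congr 3 with x
      rw [List.foldr_cons]
      congr 1
      refine Finset.prod_congr rfl fun i _ => ?_
      by_cases hi : i = j
      · subst hi
        simp [hj]
      · simp [hi]
    · split_ifs
      · exact (hφ i).iterate _
      · exact hφ i

/-! ### The bound on the Walsh coefficients -/

lemma integral_norm_mixedPartial_le {s : ℕ} {u : ℕ → ℝ} (hu : ∀ j, 0 < u j)
    {f : (Fin s → ℝ) → ℝ} (hf : ContDiffOn ℝ ∞ f (cube s)) (hf1 : weightedNorm s u f ≤ 1)
    (α : Fin s → ℕ) :
    ∫ x in cube s, ‖(mixedPartial α f x : ℂ)‖ ≤ ∏ j : Fin s, u j ^ α j := by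
  have hpos : 0 < ∏ j : Fin s, u j ^ α j := Finset.prod_pos fun j _ => pow_pos (hu j) _
  have h1 := (le_iSup (fun α : Fin s → ℕ =>
    eLpNorm (mixedPartial α f) 1 (volume.restrict (cube s)) /
      ENNReal.ofReal (∏ j : Fin s, u j ^ α j)) α).trans hf1
  rw [ENNReal.div_le_iff (by simpa using hpos) ENNReal.ofReal_ne_top, one_mul] at h1
  have hc : ContinuousOn (mixedPartial α f) (cube s) :=
    (contDiffOn_foldr_partialDeriv α hf _).continuousOn
  have hi := hc.integrableOn_compact (μ := volume) (isCompact_cube s)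
  simp only [Complex.norm_real]
  rw [integral_norm_eq_lintegral_enorm hi.1, ← eLpNorm_one_eq_lintegral_enorm]
  exact ENNReal.toReal_le_of_le_ofReal hpos.le h1

variable {b : ℕ} [hb : Fact b.Prime]

lemma norm_setIntegral_mul_walshFun_le {s : ℕ} {u : ℕ → ℝ} (hu : ∀ j, 0 < u j)
    {f : (Fin s → ℝ) → ℝ} (hf : ContDiffOn ℝ ∞ f (cube s)) (hf1 : weightedNorm s u f ≤ 1)
    (κ : Fin s → ℕ → ZMod b) (N : ℕ) :
    ‖∫ x in cube s, (f x : ℂ) * ∏ j, walshFun (κ j) N (x j)‖ ≤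
      ∏ j : Fin s, ∏ c ∈ (Finset.range N).filter fun c => κ j c ≠ 0,
        (digitFactor b * u j) * ((b : ℝ) ^ (c + 1))⁻¹ := by
  set α : Fin s → ℕ := fun j => ((Finset.range N).filter fun c => κ j c ≠ 0).card with hα
  set B : Fin s → ℝ := fun j => ∏ c ∈ (Finset.range N).filter fun c => κ j c ≠ 0,
    ((b : ℝ) ^ (c + 1))⁻¹ * digitFactor b with hB
  have hw := fun j => walshFun_iterate_primitive (κ j) N (Nat.zero_le N)
  simp only [Nat.Ico_zero_eq_range] at hw
  have hR := fun j => rightRegular_walshFun (κ j) N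
  rw [norm_setIntegral_foldr_by_parts hf hR α (fun j => (hw j).2.2) (List.nodup_finRange s)]
  have hc : ContinuousOn (mixedPartial α f) (cube s) :=
    (contDiffOn_foldr_partialDeriv α hf _).continuousOn
  have hi : IntegrableOn (fun x => (mixedPartial α f x : ℂ)) (cube s) :=
    (Complex.continuous_ofReal.comp_continuousOn hc).integrableOn_compact (isCompact_cube s)
  have hB0 : ∀ j, 0 ≤ B j := fun j => (norm_nonneg _).trans ((hw j).2.1 0 le_rfl)
  calc _ ≤ ∫ x in cube s, ‖(mixedPartial α f x : ℂ)‖ * ∏ j, B j := by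
        refine norm_integral_le_of_norm_le (hi.norm.mul_const _) ?_
        filter_upwards [ae_restrict_mem (measurableSet_cube s)] with x hx
        rw [norm_mul, norm_prod]
        refine mul_le_mul_of_nonneg_left ?_ (norm_nonneg _)
        refine Finset.prod_le_prod (fun _ _ => norm_nonneg _) fun i _ => ?_
        rw [if_pos (List.mem_finRange i)]
        exact (hw i).2.1 _ (mem_cube.1 hx i).1
    _ = (∫ x in cube s, ‖(mixedPartial α f x : ℂ)‖) * ∏ j, B j := integral_mul_const _ _
    _ ≤ (∏ j : Fin s, u j ^ α j) * ∏ j, B j :=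
        mul_le_mul_of_nonneg_right (integral_norm_mixedPartial_le hu hf hf1 α)
          (Finset.prod_nonneg fun j _ => hB0 j)
    _ = _ := by
        rw [← Finset.prod_mul_distrib]
        refine Finset.prod_congr rfl fun j _ => ?_
        rw [hα, hB]
        dsimp only
        rw [← Finset.prod_const, ← Finset.prod_mul_distrib]
        exact Finset.prod_congr rfl fun c _ => by ring

end

/-! ### Sums over digits -/

@[to_additive sum_range_mul_eq]
lemma prod_range_mul_eq {M : Type*} [CommMonoid M] (d n : ℕ) (f : ℕ → M) :
    ∏ c ∈ Finset.range (d * n), f c =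
      ∏ i ∈ Finset.range n, ∏ h ∈ Finset.range d, f (d * i + h) := by
  induction n with
  | zero => simp
  | succ n ih => rw [mul_add, mul_one, Finset.prod_range_add, ih, Finset.prod_range_succ]

lemma natDigit_mul_add_zero {b k a : ℕ} (ha : a < b) : natDigit b (b * k + a) 0 = a := by
  simp [natDigit, Nat.mod_eq_of_lt ha]

lemma natDigit_mul_add_succ {b k a : ℕ} (ha : a < b) (i : ℕ) :
    natDigit b (b * k + a) (i + 1) = natDigit b k i := by
  have hb : 0 < b := by omega
  rw [natDigit, natDigit, pow_succ', ← Nat.div_div_eq_div_mul, Nat.mul_add_div hb,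
    Nat.div_eq_of_lt ha, add_zero]

lemma natDigit_lt {b : ℕ} (hb : 0 < b) (k i : ℕ) : natDigit b k i < b := Nat.mod_lt _ hb

lemma natDigit_eq_zero {b k i : ℕ} (h : k < b ^ i) : natDigit b k i = 0 := by
  rw [natDigit, Nat.div_eq_of_lt h, Nat.zero_mod]

lemma sum_range_pow_prod_natDigit {R : Type*} [CommSemiring R] {b : ℕ} (n : ℕ)
    (F : ℕ → ℕ → R) :
    ∑ k ∈ Finset.range (b ^ n), ∏ i ∈ Finset.range n, F i (natDigit b k i) =
      ∏ i ∈ Finset.range n, ∑ a ∈ Finset.range b, F i a := by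
  induction n generalizing F with
  | zero => simp
  | succ n ih =>
    rw [pow_succ', sum_range_mul_eq, Finset.prod_range_succ', ← ih, Finset.sum_mul]
    refine Finset.sum_congr rfl fun k _ => ?_
    rw [Finset.mul_sum]
    refine Finset.sum_congr rfl fun a ha => ?_
    have ha := Finset.mem_range.1 ha
    rw [Finset.prod_range_succ', natDigit_mul_add_zero ha]
    simp_rw [natDigit_mul_add_succ ha]

/-- The frequency vectors whose components have at most `n` digits. -/
def box (b t n : ℕ) : Finset (Fin t → ℕ) := Fintype.piFinset fun _ => Finset.range (b ^ n)

lemma mem_box {b t n : ℕ} {k : Fin t → ℕ} : k ∈ box b t n ↔ ∀ j, k j < b ^ n := by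
  simp [box]

lemma sum_box_prod_natDigit {R : Type*} [CommSemiring R] {b t : ℕ} (n : ℕ)
    (F : Fin t → ℕ → ℕ → R) :
    ∑ k ∈ box b t n, ∏ j, ∏ i ∈ Finset.range n, F j i (natDigit b (k j) i) =
      ∏ j, ∏ i ∈ Finset.range n, ∑ a ∈ Finset.range b, F j i a := by
  simp_rw [← sum_range_pow_prod_natDigit]
  rw [Finset.prod_univ_sum]
  rfl

lemma exists_subset_box {b t : ℕ} (hb : 1 < b) (S : Finset (Fin t → ℕ)) :
    ∃ n, S ⊆ box b t n := by
  refine ⟨∑ k ∈ S, ∑ j, k j, fun k hk => mem_box.2 fun j => ?_⟩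
  refine (?_ : k j ≤ _).trans_lt (Nat.lt_pow_self hb)
  exact (Finset.single_le_sum (f := fun j => k j) (fun _ _ => Nat.zero_le _)
    (Finset.mem_univ j)).trans
    (Finset.single_le_sum (f := fun k => ∑ j, k j) (fun _ _ => Nat.zero_le _) hk)

section

variable {b : ℕ} [hb : Fact b.Prime]

lemma natCast_natDigit_ne_zero_iff (k i : ℕ) :
    (natDigit b k i : ZMod b) ≠ 0 ↔ natDigit b k i ≠ 0 := by
  rw [Ne, ZMod.natCast_eq_zero_iff, not_iff_not]
  exact ⟨fun h => Nat.eq_zero_of_dvd_of_lt h (natDigit_lt hb.out.pos _ _), fun h => h ▸ dvd_zero b⟩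

lemma sum_range_stdAddChar (x : ZMod b) :
    ∑ a ∈ Finset.range b, (ZMod.stdAddChar ((a : ZMod b) * x) : ℂ) = if x = 0 then (b : ℂ) else 0 := by
  split_ifs with h
  · simp [h]
  · simp_rw [mul_comm _ x]
    exact sum_stdAddChar_eq_zero h

/-! ### The weights -/

/-- The factor contributed to `b^{-μ̃}` by a nonzero digit in position `i` of the component `(j,h)`. -/
def digitWeight (b d : ℕ) (u : ℕ → ℝ) (j h i : ℕ) : ℝ :=
  (digitFactor b * u j) * ((b : ℝ) ^ (d * i + h + 1))⁻¹

lemma digitWeight_pos {u : ℕ → ℝ} (hu : ∀ j, 0 < u j) (d j h i : ℕ) :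
    0 < digitWeight b d u j h i := by
  have h0 : (0 : ℝ) < b := by exact_mod_cast hb.out.pos
  have := digitFactor_pos (b := b)
  have := hu j
  unfold digitWeight
  positivity

lemma muTilde₁_eq {d : ℕ} (a : ℝ) (h : ℕ) {k n : ℕ} (hk : k < b ^ n) :
    muTilde₁ b d a h k =
      ∑ i ∈ (Finset.range n).filter fun i => natDigit b k i ≠ 0, ((d * i + h : ℕ) + a : ℝ) := by
  rw [muTilde₁]
  refine Finset.sum_congr ?_ fun _ _ => rfl
  ext i
  simp only [Finset.mem_filter, Finset.mem_range, and_congr_left_iff]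
  intro hi
  have h1 : b ^ i ≤ k := by
    by_contra h
    exact hi (natDigit_eq_zero (not_le.1 h))
  have h2 : i < n := (Nat.pow_lt_pow_iff_right hb.out.one_lt).1 (h1.trans_lt hk)
  have h3 : i ≤ Nat.log b k := Nat.le_log_of_pow_le hb.out.one_lt h1
  omega

lemma rpow_neg_muTilde₁ {u : ℕ → ℝ} (hu : ∀ j, 0 < u j) (d j h : ℕ) {k n : ℕ} (hk : k < b ^ n) :
    (b : ℝ) ^ (-muTilde₁ b d (shift b u j) (h + 1) k) =
      ∏ i ∈ Finset.range n, if natDigit b k i ≠ 0 then digitWeight b d u j h i else 1 := by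
  have h0 : (0 : ℝ) < b := by exact_mod_cast hb.out.pos
  have h1 : (b : ℝ) ≠ 1 := by exact_mod_cast hb.out.one_lt.ne'
  rw [muTilde₁_eq _ _ hk, ← Finset.prod_filter, ← Finset.sum_neg_distrib, Real.rpow_sum_of_pos h0]
  refine Finset.prod_congr rfl fun i _ => ?_
  rw [neg_add, Real.rpow_add h0, shift, neg_neg,
    ← digitFactor, Real.rpow_logb h0 h1 (mul_pos digitFactor_pos (hu j)), Real.rpow_neg h0.le, Real.rpow_natCast,
    mul_comm, digitWeight, add_assoc]

lemma rpow_neg_muTilde {u : ℕ → ℝ} (hu : ∀ j, 0 < u j) {s d n : ℕ} {k : Fin (s * d) → ℕ}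
    (hk : k ∈ box b (s * d) n) :
    (b : ℝ) ^ (-muTilde b s d (shift b u) k) =
      ∏ j : Fin s, ∏ h : Fin d, ∏ i ∈ Finset.range n,
        if natDigit b (k (finProdFinEquiv (j, h))) i ≠ 0 then digitWeight b d u j h i else 1 := by
  have h0 : (0 : ℝ) < b := by exact_mod_cast hb.out.pos
  rw [muTilde, ← Finset.sum_neg_distrib, Real.rpow_sum_of_pos h0]
  refine Finset.prod_congr rfl fun j _ => ?_
  rw [← Finset.sum_neg_distrib, Real.rpow_sum_of_pos h0]
  exact Finset.prod_congr rfl fun h _ => rpow_neg_muTilde₁ hu d j h (mem_box.1 hk _)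

lemma prod_finProdFinEquiv {M : Type*} [CommMonoid M] {s d : ℕ} (F : Fin (s * d) → M) :
    ∏ j : Fin s, ∏ h : Fin d, F (finProdFinEquiv (j, h)) = ∏ t, F t := by
  rw [← Fintype.prod_prod_type' (f := fun j h => F (finProdFinEquiv (j, h)))]
  exact Equiv.prod_comp finProdFinEquiv F

lemma sum_digitWeight_le {u : ℕ → ℝ} (hu : ∀ j, 0 < u j) {d : ℕ} (hd : 1 ≤ d) (j h n : ℕ) :
    ∑ i ∈ Finset.range n, digitWeight b d u j h i ≤ 2 * (digitFactor b * u j) := by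
  have h0 : (2 : ℝ) ≤ b := by exact_mod_cast hb.out.two_le
  have hK : 0 < digitFactor b * u j := mul_pos digitFactor_pos (hu j)
  calc _ ≤ ∑ i ∈ Finset.range n, (digitFactor b * u j) * (1 / 2 : ℝ) ^ i := by
        refine Finset.sum_le_sum fun i _ => mul_le_mul_of_nonneg_left ?_ hK.le
        rw [one_div, inv_pow]
        refine inv_anti₀ (by positivity) ?_
        calc (2 : ℝ) ^ i ≤ (b : ℝ) ^ i := by gcongr
          _ ≤ (b : ℝ) ^ (d * i + h + 1) := by
            refine pow_le_pow_right₀ (by linarith) ?_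
            nlinarith
    _ = (digitFactor b * u j) * ∑ i ∈ Finset.range n, (1 / 2 : ℝ) ^ i := by rw [Finset.mul_sum]
    _ ≤ (digitFactor b * u j) * 2 := by
        refine mul_le_mul_of_nonneg_left ?_ hK.le
        exact sum_geometric_two_le n
    _ = _ := mul_comm _ _

lemma sum_range_ite_ne_zero {n : ℕ} (hn : 0 < n) (w : ℝ) :
    ∑ a ∈ Finset.range n, (if a ≠ 0 then w else 1) = (n - 1) * w + 1 := by
  obtain ⟨c, rfl⟩ := Nat.exists_eq_succ_of_ne_zero hn.ne'
  rw [Finset.sum_range_succ']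
  simp

lemma sum_box_rpow_neg_muTilde_le {u : ℕ → ℝ} (hu : ∀ j, 0 < u j) {s d : ℕ} (hd : 1 ≤ d) (n : ℕ) :
    ∑ k ∈ box b (s * d) n, (b : ℝ) ^ (-muTilde b s d (shift b u) k) ≤
      ∏ j : Fin s, ∏ _h : Fin d, Real.exp (b * (2 * (digitFactor b * u j))) := by
  let F : Fin (s * d) → ℕ → ℕ → ℝ := fun t i a =>
    if a ≠ 0 then digitWeight b d u (finProdFinEquiv.symm t).1 (finProdFinEquiv.symm t).2 i else 1
  have h1 : ∀ k ∈ box b (s * d) n, (b : ℝ) ^ (-muTilde b s d (shift b u) k) =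
      ∏ t, ∏ i ∈ Finset.range n, F t i (natDigit b (k t) i) := by
    intro k hk
    rw [rpow_neg_muTilde hu hk, ← prod_finProdFinEquiv]
    simp only [F, Equiv.symm_apply_apply]
  rw [Finset.sum_congr rfl h1, sum_box_prod_natDigit, ← prod_finProdFinEquiv]
  have hw := digitWeight_pos (b := b) hu d
  have hF : ∀ t i, 0 ≤ ∑ a ∈ Finset.range b, F t i a := fun t i =>
    Finset.sum_nonneg fun a _ => by
      dsimp only [F]
      split_ifs
      · exact (hw _ _ _).le
      · exact zero_le_one
  refine Finset.prod_le_prod (fun j _ => Finset.prod_nonneg fun h _ =>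
    Finset.prod_nonneg fun i _ => hF _ _) fun j _ => ?_
  refine Finset.prod_le_prod (fun h _ => Finset.prod_nonneg fun i _ => hF _ _) fun h _ => ?_
  have h0 : (0 : ℝ) ≤ b := Nat.cast_nonneg b
  calc _ ≤ ∏ i ∈ Finset.range n, Real.exp (b * digitWeight b d u j h i) := by
        refine Finset.prod_le_prod (fun i _ => hF _ _) fun i _ => ?_
        refine le_trans ?_ (Real.add_one_le_exp _)
        have h2 := hw j h i
        simp only [F, Equiv.symm_apply_apply]
        rw [sum_range_ite_ne_zero hb.out.pos]
        nlinarith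
    _ = Real.exp (b * ∑ i ∈ Finset.range n, digitWeight b d u j h i) := by
        rw [Finset.mul_sum, Real.exp_sum]
    _ ≤ _ := by
        gcongr
        exact sum_digitWeight_le hu hd _ _ _

lemma summable_rpow_neg_muTilde {u : ℕ → ℝ} (hu : ∀ j, 0 < u j) {s d : ℕ} (hd : 1 ≤ d) :
    Summable fun k : Fin (s * d) → ℕ => (b : ℝ) ^ (-muTilde b s d (shift b u) k) := by
  refine summable_of_sum_le
    (c := ∏ j : Fin s, ∏ _h : Fin d, Real.exp (b * (2 * (digitFactor b * u j))))
    (fun k => Real.rpow_nonneg (Nat.cast_nonneg b) _) fun S => ?_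
  · obtain ⟨n, hn⟩ := exists_subset_box (b := b) hb.out.one_lt S
    exact (Finset.sum_le_sum_of_subset_of_nonneg hn fun k _ _ =>
      Real.rpow_nonneg (Nat.cast_nonneg b) _).trans (sum_box_rpow_neg_muTilde_le hu hd n)

/-! ### Interlaced frequencies and the Walsh-Dirichlet kernel -/

/-- The digits of the frequency in the coordinate `j` obtained by interlacing the digits of `k`. -/
def interlacedDigit (b : ℕ) {s d : ℕ} [NeZero d] (k : Fin (s * d) → ℕ) (j : Fin s) (c : ℕ) :
    ZMod b :=
  natDigit b (k (finProdFinEquiv (j, Fin.ofNat d c))) (c / d)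

lemma interlacedDigit_mul_add {s d : ℕ} [NeZero d] (k : Fin (s * d) → ℕ) (j : Fin s) (i : ℕ)
    (h : Fin d) :
    interlacedDigit b k j (d * i + h) = natDigit b (k (finProdFinEquiv (j, h))) i := by
  have h1 : Fin.ofNat d (d * i + h) = h := by
    ext
    simp [Fin.ofNat, Nat.mod_eq_of_lt h.2]
  rw [interlacedDigit, h1, Nat.mul_add_div (Nat.pos_of_ne_zero (NeZero.ne d)),
    Nat.div_eq_of_lt h.2, add_zero]

@[to_additive sum_range_mul_eq_sum_fin]
lemma prod_range_mul_eq_prod_fin {M : Type*} [CommMonoid M] (d n : ℕ) (f : ℕ → M) :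
    ∏ c ∈ Finset.range (d * n), f c =
      ∏ h : Fin d, ∏ i ∈ Finset.range n, f (d * i + h) := by
  rw [prod_range_mul_eq, Finset.prod_comm, Finset.prod_range]

lemma norm_walshCoeff_le {s d : ℕ} [NeZero d] {u : ℕ → ℝ} (hu : ∀ j, 0 < u j)
    {f : (Fin s → ℝ) → ℝ} (hf : ContDiffOn ℝ ∞ f (cube s)) (hf1 : weightedNorm s u f ≤ 1)
    {n : ℕ} {k : Fin (s * d) → ℕ} (hk : k ∈ box b (s * d) n) :
    ‖∫ x in cube s, (f x : ℂ) * ∏ j, walshFun (interlacedDigit b k j) (d * n) (x j)‖ ≤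
      (b : ℝ) ^ (-muTilde b s d (shift b u) k) := by
  refine (norm_setIntegral_mul_walshFun_le hu hf hf1 (interlacedDigit b k) (d * n)).trans_eq ?_
  rw [rpow_neg_muTilde hu hk]
  refine Finset.prod_congr rfl fun j _ => ?_
  rw [Finset.prod_filter, prod_range_mul_eq_prod_fin]
  simp_rw [interlacedDigit_mul_add, natCast_natDigit_ne_zero_iff]
  rfl

lemma walsh_eq_prod (κ : ℕ → ZMod b) (N l : ℕ) :
    walsh κ N l = ∏ c ∈ Finset.range N,
      ZMod.stdAddChar (κ c * ((l / b ^ (N - 1 - c) : ℕ) : ZMod b)) := by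
  induction N generalizing l with
  | zero => simp [walsh]
  | succ N ih =>
    rw [walsh, ih, Finset.prod_range_succ]
    congr 1
    · refine Finset.prod_congr rfl fun c hc => ?_
      have hc := Finset.mem_range.1 hc
      rw [Nat.div_div_eq_div_mul, ← pow_succ', show N - 1 - c + 1 = N + 1 - 1 - c by omega]
    · simp

lemma eq_of_natCast_div_eq {N l l' : ℕ} (hl : l < b ^ N) (hl' : l' < b ^ N)
    (h : ∀ c < N, ((l / b ^ c : ℕ) : ZMod b) = ((l' / b ^ c : ℕ) : ZMod b)) : l = l' := by
  induction N generalizing l l' with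
  | zero => simp at hl hl'; omega
  | succ N ih =>
    have h0 := h 0 (Nat.succ_pos N)
    rw [pow_zero, Nat.div_one, Nat.div_one, ZMod.natCast_eq_natCast_iff'] at h0
    have h1 : l / b = l' / b := by
      refine ih (Nat.div_lt_of_lt_mul (by rwa [← pow_succ']))
        (Nat.div_lt_of_lt_mul (by rwa [← pow_succ'])) fun c hc => ?_
      have := h (c + 1) (by omega)
      rwa [pow_succ', ← Nat.div_div_eq_div_mul, ← Nat.div_div_eq_div_mul] at this
    rw [← Nat.div_add_mod l b, ← Nat.div_add_mod l' b, h0, h1]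

lemma sum_box_walsh_mul_conj {s d : ℕ} [NeZero d] (n : ℕ) {l l' : Fin s → ℕ}
    (hl : ∀ j, l j < b ^ (d * n)) (hl' : ∀ j, l' j < b ^ (d * n)) :
    ∑ k ∈ box b (s * d) n, (∏ j, walsh (interlacedDigit b k j) (d * n) (l j)) *
        starRingEnd ℂ (∏ j, walsh (interlacedDigit b k j) (d * n) (l' j)) =
      if l = l' then ((b : ℂ) ^ (d * n)) ^ s else 0 := by
  let δ : Fin s → ℕ → ZMod b := fun j c =>
    ((l j / b ^ (d * n - 1 - c) : ℕ) : ZMod b) - ((l' j / b ^ (d * n - 1 - c) : ℕ) : ZMod b)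
  let F : Fin (s * d) → ℕ → ℕ → ℂ := fun t i a => ZMod.stdAddChar ((a : ZMod b) *
    δ (finProdFinEquiv.symm t).1 (d * i + (finProdFinEquiv.symm t).2))
  have hconj : ∀ a : ZMod b, starRingEnd ℂ (ZMod.stdAddChar a) = ZMod.stdAddChar (-a) := by
    intro a
    rw [AddChar.map_neg_eq_conj]
  have h1 : ∀ k : Fin (s * d) → ℕ, (∏ j, walsh (interlacedDigit b k j) (d * n) (l j)) *
        starRingEnd ℂ (∏ j, walsh (interlacedDigit b k j) (d * n) (l' j)) =
      ∏ t, ∏ i ∈ Finset.range n, F t i (natDigit b (k t) i) := by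
    intro k
    rw [map_prod, ← Finset.prod_mul_distrib, ← prod_finProdFinEquiv]
    refine Finset.prod_congr rfl fun j _ => ?_
    rw [walsh_eq_prod, walsh_eq_prod, map_prod, ← Finset.prod_mul_distrib,
      prod_range_mul_eq_prod_fin]
    refine Finset.prod_congr rfl fun h _ => Finset.prod_congr rfl fun i _ => ?_
    rw [hconj, ← AddChar.map_add_eq_mul, interlacedDigit_mul_add]
    simp only [F, δ, Equiv.symm_apply_apply]
    congr 1
    ring
  simp_rw [h1]
  rw [sum_box_prod_natDigit, ← prod_finProdFinEquiv]
  simp only [F, Equiv.symm_apply_apply, sum_range_stdAddChar]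
  have h2 : ∀ j, ∏ h : Fin d, ∏ i ∈ Finset.range n, (if δ j (d * i + h) = 0 then (b : ℂ) else 0) =
      ∏ c ∈ Finset.range (d * n), if δ j c = 0 then (b : ℂ) else 0 := fun j =>
    (prod_range_mul_eq_prod_fin d n fun c => if δ j c = 0 then (b : ℂ) else 0).symm
  simp_rw [h2]
  split_ifs with hll
  · subst hll
    simp [δ]
  · obtain ⟨j, hj⟩ : ∃ j, l j ≠ l' j := by
      by_contra! h
      exact hll (funext h)
    obtain ⟨c, hc, hδ⟩ : ∃ c < d * n, δ j c ≠ 0 := by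
      by_contra! h
      refine hj (eq_of_natCast_div_eq (hl j) (hl' j) fun c hc => ?_)
      have := h (d * n - 1 - c) (by omega)
      simp only [δ] at this
      rw [show d * n - 1 - (d * n - 1 - c) = c by omega, sub_eq_zero] at this
      exact this
    refine Finset.prod_eq_zero (Finset.mem_univ j) ?_
    exact Finset.prod_eq_zero (Finset.mem_range.2 hc) (if_neg hδ)

end

section

lemma stdAddChar_sum {b : ℕ} [NeZero b] {ι : Type*} (S : Finset ι) (a : ι → ZMod b) :
    (ZMod.stdAddChar (∑ i ∈ S, a i) : ℂ) = ∏ i ∈ S, ZMod.stdAddChar (a i) := by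
  classical
  induction S using Finset.induction_on with
  | empty => simp
  | insert i S hi ih => rw [Finset.sum_insert hi, Finset.prod_insert hi, AddChar.map_add_eq_mul, ih]

/-! ### Numbers with a finite expansion -/

/-- The integer with the base `b` digits `τ 0, …, τ (N-1)`, the leading digit first. -/
def ofLeadingDigits (b : ℕ) (τ : ℕ → ℕ) : ℕ → ℕ
  | 0 => 0
  | N + 1 => b * ofLeadingDigits b τ N + τ N

section

variable {b : ℕ} {τ : ℕ → ℕ}

lemma ofLeadingDigits_lt (hτ : ∀ c, τ c < b) (N : ℕ) : ofLeadingDigits b τ N < b ^ N := by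
  induction N with
  | zero => simp [ofLeadingDigits]
  | succ N ih =>
    have := hτ N
    rw [ofLeadingDigits, pow_succ']
    nlinarith

lemma ofLeadingDigits_add_div (hτ : ∀ c, τ c < b) (N r : ℕ) :
    ofLeadingDigits b τ (N + r) / b ^ r = ofLeadingDigits b τ N := by
  induction r with
  | zero => simp
  | succ r ih =>
    have := hτ (N + r)
    rw [← add_assoc, ofLeadingDigits, pow_succ', ← Nat.div_div_eq_div_mul,
      Nat.mul_add_div (by omega), Nat.div_eq_of_lt this, add_zero, ih]

lemma ofLeadingDigits_div_pow (hb : 0 < b) (τ : ℕ → ℕ) (N : ℕ) :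
    (ofLeadingDigits b τ N : ℝ) / (b : ℝ) ^ N =
      ∑ c ∈ Finset.range N, (τ c : ℝ) * ((b : ℝ) ^ (c + 1))⁻¹ := by
  have hb0 : (b : ℝ) ≠ 0 := by exact_mod_cast hb.ne'
  induction N with
  | zero => simp [ofLeadingDigits]
  | succ N ih =>
    rw [Finset.sum_range_succ, ← ih, ofLeadingDigits]
    push_cast
    field_simp
    ring

lemma digits_ofLeadingDigits_div [NeZero b] (hτ : ∀ c, τ c < b) (m i : ℕ) :
    (Real.digits ((ofLeadingDigits b τ m : ℝ) / (b : ℝ) ^ m) b i : ℕ) =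
      if i < m then τ i else 0 := by
  have hb0 : (b : ℝ) ≠ 0 := by exact_mod_cast NeZero.ne b
  simp only [Real.digits, Fin.ofNat]
  split_ifs with h
  · obtain ⟨r, rfl⟩ : ∃ r, m = i + 1 + r := ⟨m - (i + 1), by omega⟩
    have h1 : (ofLeadingDigits b τ (i + 1 + r) : ℝ) / (b : ℝ) ^ (i + 1 + r) * (b : ℝ) ^ (i + 1) =
        (ofLeadingDigits b τ (i + 1 + r) : ℝ) / ((b ^ r : ℕ) : ℝ) := by
      push_cast
      field_simp
      ring
    rw [h1, Nat.floor_div_eq_div, ofLeadingDigits_add_div hτ, ofLeadingDigits,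
      Nat.mul_add_mod, Nat.mod_eq_of_lt (hτ i)]
  · obtain ⟨r, rfl⟩ : ∃ r, i = m + r := ⟨i - m, by omega⟩
    have h1 : (ofLeadingDigits b τ m : ℝ) / (b : ℝ) ^ m * (b : ℝ) ^ (m + r + 1) =
        ((b * (ofLeadingDigits b τ m * b ^ r) : ℕ) : ℝ) := by
      push_cast
      field_simp
      ring
    rw [h1, Nat.floor_natCast, Nat.mul_mod_right]

/-- The digits of the interlaced number. -/
def interlacedDigits {d : ℕ} [NeZero d] (m : ℕ) (τ : Fin d → ℕ → ℕ) (c : ℕ) : ℕ :=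
  if c / d < m then τ (Fin.ofNat d c) (c / d) else 0

lemma interlacedDigits_mul_add {d : ℕ} [NeZero d] (m : ℕ) (τ : Fin d → ℕ → ℕ) (i : ℕ) (h : Fin d) :
    interlacedDigits m τ (d * i + h) = if i < m then τ h i else 0 := by
  have h1 : Fin.ofNat d (d * i + h) = h := by
    ext
    simp [Fin.ofNat, Nat.mod_eq_of_lt h.2]
  rw [interlacedDigits, h1, Nat.mul_add_div (Nat.pos_of_ne_zero (NeZero.ne d)),
    Nat.div_eq_of_lt h.2, add_zero]

lemma interlace_ofLeadingDigits_div [NeZero b] {d : ℕ} [NeZero d] {τ : Fin d → ℕ → ℕ}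
    (hτ : ∀ h c, τ h c < b) {m n : ℕ} (hmn : m ≤ n) :
    interlace b (fun h : Fin d => (ofLeadingDigits b (τ h) m : ℝ) / (b : ℝ) ^ m) =
      (ofLeadingDigits b (interlacedDigits m τ) (d * n) : ℝ) / (b : ℝ) ^ (d * n) := by
  rw [interlace, ofLeadingDigits_div_pow (Nat.pos_of_ne_zero (NeZero.ne b)),
    sum_range_mul_eq_sum_fin, Finset.sum_comm]
  simp_rw [digits_ofLeadingDigits_div (hτ _), interlacedDigits_mul_add]
  refine tsum_eq_sum fun i hi => ?_
  have hi : ¬ i < m := fun h => hi (Finset.mem_range.2 (h.trans_le hmn))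
  simp [hi]

end

variable {b : ℕ} [hb : Fact b.Prime]

lemma walsh_ofLeadingDigits (κ : ℕ → ZMod b) (τ : ℕ → ZMod b) (N : ℕ) :
    walsh κ N (ofLeadingDigits b (fun c => (τ c).val) N) =
      ∏ c ∈ Finset.range N, ZMod.stdAddChar (κ c * τ c) := by
  induction N with
  | zero => simp [walsh]
  | succ N ih =>
    rw [Finset.prod_range_succ, ofLeadingDigits, walsh_succ_mul_add _ _ _ (ZMod.val_lt _), ih,
      ZMod.natCast_zmod_val]

lemma laurentToReal_eq (m : ℕ) (L : LaurentSeries (ZMod b)) :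
    laurentToReal b m L =
      (ofLeadingDigits b (fun i => (L.coeff ((i + 1 : ℕ) : ℤ)).val) m : ℝ) / (b : ℝ) ^ m := by
  rw [laurentToReal, ofLeadingDigits_div_pow hb.out.pos, Finset.range_eq_Ico,
    Finset.sum_Ico_add' (fun l : ℕ => ((L.coeff (l : ℤ)).val : ℝ) * ((b : ℝ) ^ l)⁻¹) 0 m 1,
    zero_add]
  rfl

/-! ### Polynomials as Laurent series -/

open Polynomial

lemma toLaurent_monomial (i : ℕ) (a : ZMod b) :
    toLaurent b (monomial i a) = HahnSeries.single (-(i : ℤ)) a := by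
  rw [toLaurent, aeval_monomial, HahnSeries.algebraMap_apply', PowerSeries.algebraMap_apply,
    HahnSeries.ofPowerSeries_C, HahnSeries.single_pow, HahnSeries.C_apply,
    HahnSeries.single_mul_single]
  simp

lemma toLaurent_add (A B : (ZMod b)[X]) : toLaurent b (A + B) = toLaurent b A + toLaurent b B :=
  map_add _ _ _

lemma toLaurent_mul (A B : (ZMod b)[X]) : toLaurent b (A * B) = toLaurent b A * toLaurent b B :=
  map_mul _ _ _

lemma toLaurent_sum {ι : Type*} (S : Finset ι) (A : ι → (ZMod b)[X]) :
    toLaurent b (∑ i ∈ S, A i) = ∑ i ∈ S, toLaurent b (A i) :=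
  map_sum (aeval (HahnSeries.single (-1 : ℤ) (1 : ZMod b))) _ _

lemma coeff_toLaurent (A : (ZMod b)[X]) (k : ℤ) :
    (toLaurent b A).coeff k = if k ≤ 0 then A.coeff (-k).toNat else 0 := by
  induction A using Polynomial.induction_on' with
  | add A B hA hB =>
    rw [toLaurent_add, HahnSeries.coeff_add, hA, hB]
    split_ifs <;> simp
  | monomial i a =>
    rw [toLaurent_monomial, HahnSeries.coeff_single, coeff_monomial]
    by_cases h : k = -(i : ℤ)
    · subst h
      simp
    · rw [if_neg h]
      split_ifs with h1 h2
      · omega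
      · rfl
      · rfl

lemma toLaurent_ne_zero {A : (ZMod b)[X]} (hA : A ≠ 0) : toLaurent b A ≠ 0 := by
  intro h
  have h1 := coeff_toLaurent A (-(A.natDegree : ℤ))
  rw [h] at h1
  simp at h1
  exact hA (leadingCoeff_eq_zero.1 h1.symm)

lemma order_toLaurent {A : (ZMod b)[X]} (hA : A ≠ 0) :
    (toLaurent b A).order = -(A.natDegree : ℤ) := by
  refine le_antisymm (HahnSeries.order_le_of_coeff_ne_zero ?_) ?_
  · rw [coeff_toLaurent]
    simpa using hA
  · by_contra! h
    have h1 : (toLaurent b A).coeff (toLaurent b A).order ≠ 0 := by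
      rw [Ne, HahnSeries.coeff_order_eq_zero]
      exact toLaurent_ne_zero hA
    rw [coeff_toLaurent, if_pos (by omega)] at h1
    exact h1 (coeff_eq_zero_of_natDegree_lt (by omega))

/-- `p` divides `A` iff the first `deg p` coefficients of the fractional part of `A / p` vanish. -/
lemma dvd_iff_coeff_div_eq_zero {p : (ZMod b)[X]} (hp : p ≠ 0) (A : (ZMod b)[X]) :
    p ∣ A ↔ ∀ i < p.natDegree,
      (toLaurent b A / toLaurent b p).coeff ((i + 1 : ℕ) : ℤ) = 0 := by
  have hp' := toLaurent_ne_zero hp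
  have hpoly : ∀ (B : (ZMod b)[X]) (i : ℕ), (toLaurent b B).coeff ((i + 1 : ℕ) : ℤ) = 0 := by
    intro B i
    rw [coeff_toLaurent, if_neg (by omega)]
  constructor
  · rintro ⟨B, rfl⟩ i _
    rw [toLaurent_mul, mul_div_cancel_left₀ _ hp', hpoly]
  · intro h
    rw [← EuclideanDomain.mod_eq_zero]
    by_contra hR
    set R := A % p with hRdef
    have hdeg : R.natDegree < p.natDegree :=
      natDegree_lt_natDegree hR (EuclideanDomain.mod_lt A hp)
    have hA : toLaurent b A / toLaurent b p =
        toLaurent b (A / p) + toLaurent b R / toLaurent b p := by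
      rw [div_eq_iff hp', add_mul, div_mul_cancel₀ _ hp', ← toLaurent_mul, ← toLaurent_add,
        mul_comm, EuclideanDomain.div_add_mod]
    set L := toLaurent b R / toLaurent b p with hL
    have hL0 : L ≠ 0 := div_ne_zero (toLaurent_ne_zero hR) hp'
    have hord : L.order = ((p.natDegree - R.natDegree - 1 + 1 : ℕ) : ℤ) := by
      have h1 : L * toLaurent b p = toLaurent b R := div_mul_cancel₀ _ hp'
      have h2 := congrArg HahnSeries.order h1
      rw [HahnSeries.order_mul hL0 hp', order_toLaurent hp, order_toLaurent hR] at h2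
      omega
    have h3 := h (p.natDegree - R.natDegree - 1) (by omega)
    rw [hA, HahnSeries.coeff_add, hpoly, zero_add, ← hord, HahnSeries.coeff_order_eq_zero] at h3
    exact hL0 h3

lemma natPoly_eq_truncPoly {m n : ℕ} (hm : 1 ≤ m) (hn : n < b ^ m) :
    natPoly b n = truncPoly b m n := by
  rw [natPoly, truncPoly]
  refine Finset.sum_subset (fun i hi => ?_) fun i _ hi => ?_
  · rw [Finset.mem_range] at hi ⊢
    rcases eq_or_ne n 0 with rfl | h0
    · rw [Nat.log_zero_right] at hi
      omega
    · have := Nat.log_lt_of_lt_pow h0 hn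
      omega
  · rw [Finset.mem_range, not_lt] at hi
    rw [natDigit_eq_zero ((Nat.lt_pow_succ_log_self hb.out.one_lt n).trans_le
      (Nat.pow_le_pow_right hb.out.pos hi))]
    simp

lemma coeff_one_truncPoly_mul_div (p A : (ZMod b)[X]) (m k : ℕ) :
    (toLaurent b (truncPoly b m k * A) / toLaurent b p).coeff 1 =
      ∑ i ∈ Finset.range m, (natDigit b k i : ZMod b) *
        (toLaurent b A / toLaurent b p).coeff ((i + 1 : ℕ) : ℤ) := by
  rw [toLaurent_mul, mul_div_assoc, truncPoly, toLaurent_sum, Finset.sum_mul, HahnSeries.coeff_sum]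
  refine Finset.sum_congr rfl fun i _ => ?_
  have h1 : (1 : ℤ) = ((i + 1 : ℕ) : ℤ) + (-(i : ℤ)) := by
    push_cast
    ring
  rw [toLaurent_monomial]
  conv_lhs => rw [h1]
  rw [HahnSeries.coeff_single_mul_add]

/-! ### The interlaced polynomial lattice and its dual -/

/-- The coefficient of `x^{-(i+1)}` in `n q_t / p`. -/
def latticeDigit {t : ℕ} (p : (ZMod b)[X]) (q : Fin t → (ZMod b)[X]) (n : ℕ) (j : Fin t)
    (i : ℕ) : ZMod b :=
  (toLaurent b (natPoly b n * q j) / toLaurent b p).coeff ((i + 1 : ℕ) : ℤ)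

/-- The digits of the coordinate `j` of the `n`-th interlaced point. -/
def pointDigit {s d : ℕ} [NeZero d] (m : ℕ) (p : (ZMod b)[X]) (q : Fin (s * d) → (ZMod b)[X])
    (n : ℕ) (j : Fin s) (c : ℕ) : ZMod b :=
  if c / d < m then latticeDigit p q n (finProdFinEquiv (j, Fin.ofNat d c)) (c / d) else 0

/-- The index of the level `N` interval that contains the coordinate `j` of the `n`-th point. -/
def pointIndex {s d : ℕ} [NeZero d] (m : ℕ) (p : (ZMod b)[X]) (q : Fin (s * d) → (ZMod b)[X])
    (N n : ℕ) (j : Fin s) : ℕ :=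
  ofLeadingDigits b (fun c => (pointDigit m p q n j c).val) N

variable {s d m : ℕ} [NeZero d] (p : (ZMod b)[X]) (q : Fin (s * d) → (ZMod b)[X])

lemma pointIndex_lt (N n : ℕ) (j : Fin s) : pointIndex m p q N n j < b ^ N :=
  ofLeadingDigits_lt (fun _ => ZMod.val_lt _) N

lemma interlacedPoint_eq {n₀ : ℕ} (hm : m ≤ n₀) (n : Fin (b ^ m)) (j : Fin s) :
    interlacedPoint m s d p q n j =
      (pointIndex m p q (d * n₀) n j : ℝ) / (b : ℝ) ^ (d * n₀) := by
  rw [interlacedPoint, interlaceVec]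
  simp_rw [latticePoint, ← toLaurent_mul, laurentToReal_eq]
  rw [interlace_ofLeadingDigits_div (fun _ _ => ZMod.val_lt _) hm, pointIndex]
  congr 3
  funext c
  rw [interlacedDigits, pointDigit]
  split_ifs
  · rfl
  · simp

lemma pointDigit_mul_add (n : ℕ) (j : Fin s) (i : ℕ) (h : Fin d) :
    pointDigit m p q n j (d * i + h) =
      if i < m then latticeDigit p q n (finProdFinEquiv (j, h)) i else 0 := by
  have h1 : Fin.ofNat d (d * i + h) = h := by
    ext
    simp [Fin.ofNat, Nat.mod_eq_of_lt h.2]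
  rw [pointDigit, h1, Nat.mul_add_div (Nat.pos_of_ne_zero (NeZero.ne d)),
    Nat.div_eq_of_lt h.2, add_zero]

lemma prod_walsh_pointIndex (hm : 1 ≤ m) {n₀ : ℕ} (hmn : m ≤ n₀) (k : Fin (s * d) → ℕ) {n : ℕ}
    (hn : n < b ^ m) :
    ∏ j, walsh (interlacedDigit b k j) (d * n₀) (pointIndex m p q (d * n₀) n j) =
      ∏ i ∈ Finset.range m, ZMod.stdAddChar ((natDigit b n i : ZMod b) *
        (toLaurent b (∑ t, truncPoly b m (k t) * q t) / toLaurent b p).coeff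
          ((i + 1 : ℕ) : ℤ)) := by
  have h1 : ∀ t, ∏ i ∈ Finset.range n₀, ZMod.stdAddChar ((natDigit b (k t) i : ZMod b) *
        (if i < m then latticeDigit p q n t i else 0)) =
      (ZMod.stdAddChar ((toLaurent b (truncPoly b m (k t) * (natPoly b n * q t)) /
        toLaurent b p).coeff 1) : ℂ) := by
    intro t
    rw [coeff_one_truncPoly_mul_div, stdAddChar_sum]
    symm
    rw [← Finset.prod_subset (Finset.range_subset_range.2 hmn) fun i _ hi => ?_]
    · refine Finset.prod_congr rfl fun i hi => ?_
      rw [if_pos (Finset.mem_range.1 hi), latticeDigit]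
    · rw [if_neg (by simpa using hi)]
      simp
  simp_rw [pointIndex, walsh_ofLeadingDigits, prod_range_mul_eq_prod_fin,
    interlacedDigit_mul_add, pointDigit_mul_add, h1]
  have h2 : ∑ t, truncPoly b m (k t) * (natPoly b n * q t) =
      truncPoly b m n * ∑ t, truncPoly b m (k t) * q t := by
    rw [natPoly_eq_truncPoly hm hn, Finset.mul_sum]
    exact Finset.sum_congr rfl fun t _ => mul_left_comm _ _ _
  rw [prod_finProdFinEquiv fun t => (ZMod.stdAddChar ((toLaurent b (truncPoly b m (k t) *
    (natPoly b n * q t)) / toLaurent b p).coeff 1) : ℂ), ← stdAddChar_sum,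
    ← stdAddChar_sum, ← coeff_one_truncPoly_mul_div, ← h2, toLaurent_sum, Finset.sum_div,
    HahnSeries.coeff_sum]

/-- The character property of interlaced polynomial lattices. -/
lemma sum_prod_walsh_pointIndex (hm : 1 ≤ m) (hp : p.natDegree = m) {n₀ : ℕ} (hmn : m ≤ n₀)
    (k : Fin (s * d) → ℕ) [Decidable (k ∈ dualLattice m p q)] :
    ∑ n : Fin (b ^ m), ∏ j, walsh (interlacedDigit b k j) (d * n₀)
        (pointIndex m p q (d * n₀) n j) =
      if k ∈ dualLattice m p q then (b : ℂ) ^ m else 0 := by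
  have hp0 : p ≠ 0 := by
    rintro rfl
    simp at hp
    omega
  have hdual : k ∈ dualLattice m p q ↔ _ :=
    dvd_iff_coeff_div_eq_zero hp0 (∑ t, truncPoly b m (k t) * q t)
  rw [hp] at hdual
  rw [Finset.sum_congr rfl fun n _ => prod_walsh_pointIndex p q hm hmn k n.2]
  rw [Fin.sum_univ_eq_sum_range fun n => ∏ i ∈ Finset.range m,
    (ZMod.stdAddChar ((natDigit b n i : ZMod b) *
    (toLaurent b (∑ t, truncPoly b m (k t) * q t) / toLaurent b p).coeff ((i + 1 : ℕ) : ℤ)) : ℂ),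
    sum_range_pow_prod_natDigit m fun i a => (ZMod.stdAddChar ((a : ZMod b) *
    (toLaurent b (∑ t, truncPoly b m (k t) * q t) / toLaurent b p).coeff ((i + 1 : ℕ) : ℤ)) : ℂ)]
  simp_rw [sum_range_stdAddChar]
  split_ifs with h
  · rw [Finset.prod_congr rfl fun i hi => if_pos (hdual.1 h i (Finset.mem_range.1 hi))]
    simp
  · rw [hdual] at h
    push Not at h
    obtain ⟨i, hi, h0⟩ := h
    exact Finset.prod_eq_zero (Finset.mem_range.2 hi) (if_neg h0)

end

open Polynomial

/-! ### Walsh partial sums are averages over cells -/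

/-- The half-open `b`-adic cell of level `N` with the index `l`. -/
def cell (b N : ℕ) {s : ℕ} (l : Fin s → ℕ) : Set (Fin s → ℝ) :=
  Set.univ.pi fun j => Set.Ico ((l j : ℝ) / (b : ℝ) ^ N) ((l j + 1) / (b : ℝ) ^ N)

lemma measurableSet_cell (b N : ℕ) {s : ℕ} (l : Fin s → ℕ) : MeasurableSet (cell b N l) :=
  MeasurableSet.univ_pi fun _ => measurableSet_Ico

variable {b : ℕ} [hb : Fact b.Prime]

lemma mem_cell_iff {N s : ℕ} {l : Fin s → ℕ} {x : Fin s → ℝ} (hx : ∀ j, 0 ≤ x j) :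
    x ∈ cell b N l ↔ (fun j => ⌊(b : ℝ) ^ N * x j⌋₊) = l := by
  have hb0 : (0 : ℝ) < (b : ℝ) ^ N := pow_pos (by exact_mod_cast hb.out.pos) _
  simp only [cell, Set.mem_univ_pi, Set.mem_Ico, funext_iff]
  refine forall_congr' fun j => ?_
  rw [Nat.floor_eq_iff (mul_nonneg hb0.le (hx j)), div_le_iff₀' hb0, lt_div_iff₀' hb0]

lemma cell_subset_Ico {N s : ℕ} {l : Fin s → ℕ} (hl : ∀ j, l j < b ^ N) :
    cell b N l ⊆ Set.univ.pi fun _ => Set.Ico (0 : ℝ) 1 := by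
  have hb0 : (0 : ℝ) < (b : ℝ) ^ N := pow_pos (by exact_mod_cast hb.out.pos) _
  refine Set.pi_mono fun j _ => Set.Ico_subset_Ico (by positivity) ?_
  rw [div_le_one hb0]
  exact_mod_cast hl j

lemma volume_cell (N : ℕ) {s : ℕ} (l : Fin s → ℕ) :
    volume.real (cell b N l) = (((b : ℝ) ^ N) ^ s)⁻¹ := by
  have hb0 : (0 : ℝ) < (b : ℝ) ^ N := pow_pos (by exact_mod_cast hb.out.pos) _
  have h1 : ∀ j, ((l j : ℝ) + 1) / (b : ℝ) ^ N - (l j : ℝ) / (b : ℝ) ^ N = ((b : ℝ) ^ N)⁻¹ := by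
    intro j
    rw [← sub_div, add_sub_cancel_left, one_div]
  rw [Measure.real, cell, Real.volume_pi_Ico, ENNReal.toReal_prod]
  simp_rw [h1, ENNReal.toReal_ofReal (inv_nonneg.2 hb0.le)]
  simp

variable {s d : ℕ} [NeZero d]

/-- The Walsh coefficient of `f` at the frequency obtained by interlacing the digits of `k`. -/
def walshCoeff (b n : ℕ) [Fact b.Prime] (f : (Fin s → ℝ) → ℝ) (k : Fin (s * d) → ℕ) : ℂ :=
  ∫ x in cube s, (f x : ℂ) * ∏ j, walshFun (interlacedDigit b k j) (d * n) (x j)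

lemma sum_walshCoeff_mul_conj {f : (Fin s → ℝ) → ℝ} (hf : ContinuousOn f (cube s)) (n : ℕ)
    {l : Fin s → ℕ} (hl : ∀ j, l j < b ^ (d * n)) :
    ∑ k ∈ box b (s * d) n, walshCoeff b n f k *
        starRingEnd ℂ (∏ j, walsh (interlacedDigit b k j) (d * n) (l j)) =
      ((b : ℂ) ^ (d * n)) ^ s * ∫ x in cell b (d * n) l, (f x : ℂ) := by
  have hb0 : (0 : ℝ) < (b : ℝ) ^ (d * n) := pow_pos (by exact_mod_cast hb.out.pos) _
  have hae : (Set.univ.pi fun _ : Fin s => Set.Ico (0 : ℝ) 1) =ᵐ[volume] cube s :=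
    Measure.univ_pi_Ico_ae_eq_Icc
  simp_rw [walshCoeff, ← integral_mul_const]
  rw [← integral_finsetSum _ fun k _ => (integrableOn_mul_prod hf fun j =>
    rightRegular_walshFun (interlacedDigit b k j) (d * n)).mul_const _,
    ← setIntegral_congr_set hae, ← integral_const_mul]
  calc _ = ∫ x in Set.univ.pi fun _ : Fin s => Set.Ico (0 : ℝ) 1,
        (cell b (d * n) l).indicator (fun x => ((b : ℂ) ^ (d * n)) ^ s * (f x : ℂ)) x := by
        refine setIntegral_congr_fun (MeasurableSet.univ_pi fun _ => measurableSet_Ico)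
          fun x hx => ?_
        have hx0 : ∀ j, 0 ≤ x j := fun j => (hx j trivial).1
        have hx1 : ∀ j, ⌊(b : ℝ) ^ (d * n) * x j⌋₊ < b ^ (d * n) := by
          intro j
          rw [Nat.floor_lt (mul_nonneg hb0.le (hx0 j))]
          push_cast
          nlinarith [(hx j trivial).2]
        have h1 := sum_box_walsh_mul_conj (b := b) (d := d) n hx1 hl
        have h2 := mem_cell_iff (b := b) (N := d * n) (l := l) hx0
        simp only [walshFun, mul_assoc, ← Finset.mul_sum]
        rw [h1]
        by_cases h : x ∈ cell b (d * n) l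
        · rw [Set.indicator_of_mem h, if_pos (h2.1 h), mul_comm]
        · rw [Set.indicator_of_notMem h, if_neg fun h' => h (h2.2 h'), mul_zero]
    _ = _ := by
        rw [setIntegral_indicator (measurableSet_cell _ _ _),
          Set.inter_eq_self_of_subset_right (cell_subset_Ico hl)]

lemma norm_average_cell_sub_le {f : (Fin s → ℝ) → ℝ} (hf : ContinuousOn f (cube s)) {N : ℕ}
    {l : Fin s → ℕ} (hl : ∀ j, l j < b ^ N) {c ε : ℝ} (hε : ∀ x ∈ cell b N l, ‖f x - c‖ ≤ ε) :
    ‖((b : ℂ) ^ N) ^ s * (∫ x in cell b N l, (f x : ℂ)) - c‖ ≤ ε := by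
  have hb0 : (0 : ℝ) < ((b : ℝ) ^ N) ^ s := pow_pos (pow_pos (by exact_mod_cast hb.out.pos) _) _
  have hsub : cell b N l ⊆ cube s := fun x hx => mem_cube.2 fun j =>
    Set.Ico_subset_Icc_self (cell_subset_Ico hl hx j trivial)
  have hi : IntegrableOn (fun x => (f x : ℂ)) (cell b N l) :=
    ((Complex.continuous_ofReal.comp_continuousOn hf).integrableOn_compact
      (isCompact_cube s)).mono_set hsub
  have hfin : volume (cell b N l) < ⊤ :=
    (measure_mono hsub).trans_lt (isCompact_cube s).measure_lt_top
  have h1 : ((b : ℂ) ^ N) ^ s * (∫ x in cell b N l, (f x : ℂ)) - c =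
      ((b : ℂ) ^ N) ^ s * ∫ x in cell b N l, ((f x - c : ℝ) : ℂ) := by
    simp_rw [Complex.ofReal_sub]
    rw [integral_sub hi (integrableOn_const hfin.ne), setIntegral_const, volume_cell, mul_sub,
      Complex.real_smul]
    have hb1 : ((b : ℂ) ^ N) ^ s ≠ 0 := by exact_mod_cast hb0.ne'
    push_cast
    rw [mul_inv_cancel_left₀ hb1]
  rw [h1, norm_mul]
  have h2 := norm_setIntegral_le_of_norm_le_const (f := fun x => ((f x - c : ℝ) : ℂ)) hfin
    fun x hx => (Complex.norm_real (f x - c)).trans_le (hε x hx)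
  rw [volume_cell] at h2
  calc _ ≤ ((b : ℝ) ^ N) ^ s * (ε * (((b : ℝ) ^ N) ^ s)⁻¹) := by
        refine (mul_le_mul_of_nonneg_left h2 (norm_nonneg _)).trans_eq ?_
        simp
    _ = ε := by field_simp

lemma walsh_zero_left (N l : ℕ) : walsh (0 : ℕ → ZMod b) N l = 1 := by
  induction N generalizing l with
  | zero => rfl
  | succ N ih => simp [walsh, ih]

lemma walshCoeff_zero (n : ℕ) (f : (Fin s → ℝ) → ℝ) :
    walshCoeff b n f (0 : Fin (s * d) → ℕ) = (cubeIntegral f : ℂ) := by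
  have h : ∀ j, interlacedDigit b (0 : Fin (s * d) → ℕ) j = 0 := by
    intro j
    funext c
    simp [interlacedDigit, natDigit]
  simp only [walshCoeff, walshFun, h, walsh_zero_left, Finset.prod_const_one, mul_one]
  exact integral_complex_ofReal

/-! ### The error bound -/

variable {m : ℕ} (p : (ZMod b)[X]) (q : Fin (s * d) → (ZMod b)[X])

/-- The average of the cell means over the point set is a Walsh sum over the dual lattice. -/
lemma average_cell_eq_sum_dualLattice (hm : 1 ≤ m) (hp : p.natDegree = m) {n₀ : ℕ} (hmn : m ≤ n₀)
    {f : (Fin s → ℝ) → ℝ} (hf : ContinuousOn f (cube s)) :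
    ((b : ℂ) ^ m)⁻¹ * ∑ n : Fin (b ^ m), ((b : ℂ) ^ (d * n₀)) ^ s *
        ∫ x in cell b (d * n₀) (pointIndex m p q (d * n₀) n), (f x : ℂ) =
      ∑ k ∈ box b (s * d) n₀, (dualLattice m p q).indicator (walshCoeff b n₀ f) k := by
  classical
  have hb0 : (b : ℂ) ^ m ≠ 0 := pow_ne_zero _ (by exact_mod_cast hb.out.ne_zero)
  simp_rw [← sum_walshCoeff_mul_conj hf n₀ (pointIndex_lt p q (d * n₀) _)]
  rw [Finset.sum_comm, Finset.mul_sum]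
  refine Finset.sum_congr rfl fun k _ => ?_
  rw [← Finset.mul_sum, ← map_sum, sum_prod_walsh_pointIndex p q hm hp hmn, Set.indicator_apply]
  split_ifs
  · simp only [map_pow, Complex.conj_natCast]
    field_simp
  · simp

lemma norm_sum_dualLattice_sub_le {u : ℕ → ℝ} (hu : ∀ j, 0 < u j) {f : (Fin s → ℝ) → ℝ}
    (hf : ContDiffOn ℝ ∞ f (cube s)) (hf1 : weightedNorm s u f ≤ 1) (n₀ : ℕ) :
    ‖∑ k ∈ box b (s * d) n₀, (dualLattice m p q).indicator (walshCoeff b n₀ f) k -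
        cubeIntegral f‖ ≤
      ∑' k : ↥(dualLattice m p q \ {0}), (b : ℝ) ^ (-muTilde b s d (shift b u) k) := by
  classical
  have h0 : (0 : Fin (s * d) → ℕ) ∈ box b (s * d) n₀ :=
    mem_box.2 fun _ => pow_pos hb.out.pos _
  have h0' : (0 : Fin (s * d) → ℕ) ∈ dualLattice m p q := by
    simp [dualLattice, truncPoly, natDigit]
  have hsum := summable_rpow_neg_muTilde (b := b) hu (s := s) (d := d) (NeZero.one_le)
  have hnonneg : ∀ k : Fin (s * d) → ℕ, 0 ≤ (b : ℝ) ^ (-muTilde b s d (shift b u) k) :=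
    fun k => Real.rpow_nonneg (Nat.cast_nonneg b) _
  rw [← Finset.add_sum_erase _ _ h0, Set.indicator_of_mem h0', walshCoeff_zero,
    add_sub_cancel_left]
  calc _ ≤ ∑ k ∈ (box b (s * d) n₀).erase 0, (dualLattice m p q \ {0}).indicator
          (fun k => (b : ℝ) ^ (-muTilde b s d (shift b u) k)) k := by
        refine norm_sum_le_of_le _ fun k hk => ?_
        obtain ⟨hk0, hk⟩ := Finset.mem_erase.1 hk
        by_cases h : k ∈ dualLattice m p q
        · rw [Set.indicator_of_mem h, Set.indicator_of_mem (show k ∈ dualLattice m p q \ {0} from ⟨h, hk0⟩)]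
          exact norm_walshCoeff_le hu hf hf1 hk
        · rw [Set.indicator_of_notMem h, Set.indicator_of_notMem fun h' => h h'.1, norm_zero]
    _ ≤ ∑' k, (dualLattice m p q \ {0}).indicator
          (fun k => (b : ℝ) ^ (-muTilde b s d (shift b u) k)) k :=
        (hsum.indicator _).sum_le_tsum _ fun k _ => Set.indicator_nonneg (fun k _ => hnonneg k) k
    _ = _ := (tsum_subtype _ _).symm

lemma abs_qmcRule_sub_cubeIntegral_le (hm : 1 ≤ m) (hp : p.natDegree = m) {u : ℕ → ℝ}
    (hu : ∀ j, 0 < u j) {f : (Fin s → ℝ) → ℝ} (hf : ContDiffOn ℝ ∞ f (cube s))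
    (hf1 : weightedNorm s u f ≤ 1) :
    |qmcRule (interlacedPoint m s d p q) f - cubeIntegral f| ≤
      ∑' k : ↥(dualLattice m p q \ {0}), (b : ℝ) ^ (-muTilde b s d (shift b u) k) := by
  refine le_of_forall_pos_le_add fun ε hε => ?_
  have hb1 : (1 : ℝ) < b := by exact_mod_cast hb.out.one_lt
  obtain ⟨δ, hδ, hfδ⟩ := Metric.uniformContinuousOn_iff.1
    ((isCompact_cube s).uniformContinuousOn_of_continuous hf.continuousOn) ε hε
  obtain ⟨n₁, hn₁⟩ := exists_pow_lt_of_lt_one hδ (inv_lt_one_of_one_lt₀ hb1)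
  set n₀ := max m n₁ with hn₀
  have hmn : m ≤ n₀ := le_max_left _ _
  set N := d * n₀ with hN
  have hb0 : (0 : ℝ) < (b : ℝ) ^ N := by positivity
  have hNδ : ((b : ℝ) ^ N)⁻¹ < δ := by
    refine lt_of_le_of_lt ?_ hn₁
    rw [inv_pow]
    refine inv_anti₀ (by positivity) (pow_le_pow_right₀ hb1.le ?_)
    exact (le_max_right m n₁).trans (Nat.le_mul_of_pos_left _ (Nat.pos_of_ne_zero (NeZero.ne d)))
  have hcell : ∀ n : Fin (b ^ m), ‖((b : ℂ) ^ N) ^ s *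
      (∫ x in cell b N (pointIndex m p q N n), (f x : ℂ)) -
        (f (interlacedPoint m s d p q n) : ℂ)‖ ≤ ε := by
    intro n
    have hl := pointIndex_lt (m := m) p q N n
    have hsub := cell_subset_Ico hl
    have hpt : interlacedPoint m s d p q n ∈ cell b N (pointIndex m p q N n) := by
      intro j _
      rw [interlacedPoint_eq p q hmn]
      exact ⟨le_rfl, (div_lt_div_iff_of_pos_right hb0).2 (lt_add_one _)⟩
    have hcube : ∀ x ∈ cell b N (pointIndex m p q N n), x ∈ cube s := fun x hx =>
      mem_cube.2 fun j => Set.Ico_subset_Icc_self (hsub hx j trivial)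
    refine norm_average_cell_sub_le hf.continuousOn hl fun x hx => ?_
    rw [← dist_eq_norm]
    refine (hfδ x (hcube x hx) _ (hcube _ hpt) ?_).le
    refine lt_of_le_of_lt ((dist_pi_le_iff (inv_nonneg.2 hb0.le)).2 fun j => ?_) hNδ
    have h1 := hx j trivial
    have h2 := hpt j trivial
    simp only [Set.mem_Ico, add_div, one_div] at h1 h2
    rw [Real.dist_eq, abs_le]
    constructor <;> linarith [h1.1, h1.2, h2.1, h2.2]
  have hE := average_cell_eq_sum_dualLattice p q hm hp hmn hf.continuousOn
  have hT := norm_sum_dualLattice_sub_le (m := m) p q hu hf hf1 n₀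
  rw [← hE] at hT
  set A : Fin (b ^ m) → ℂ := fun n => ((b : ℂ) ^ N) ^ s *
      ∫ x in cell b N (pointIndex m p q N n), (f x : ℂ) with hA
  have hq : ‖(qmcRule (interlacedPoint m s d p q) f : ℂ) - ((b : ℂ) ^ m)⁻¹ * ∑ n, A n‖ ≤ ε := by
    have h1 : (qmcRule (interlacedPoint m s d p q) f : ℂ) - ((b : ℂ) ^ m)⁻¹ * ∑ n, A n =
        -(((b : ℂ) ^ m)⁻¹ * ∑ n, (A n - (f (interlacedPoint m s d p q n) : ℂ))) := by
      rw [qmcRule, Finset.sum_sub_distrib, Fintype.card_fin]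
      push_cast
      ring
    have hbm : (0 : ℝ) < (b : ℝ) ^ m := by positivity
    rw [h1, norm_neg, norm_mul]
    calc _ ≤ ‖((b : ℂ) ^ m)⁻¹‖ * ((b : ℝ) ^ m * ε) := by
          refine mul_le_mul_of_nonneg_left ?_ (norm_nonneg _)
          refine (norm_sum_le_of_le _ fun n _ => hcell n).trans_eq ?_
          simp
      _ = ε := by
          simp only [norm_inv, norm_pow, Complex.norm_natCast]
          field_simp
  calc |qmcRule (interlacedPoint m s d p q) f - cubeIntegral f|
      = ‖(qmcRule (interlacedPoint m s d p q) f : ℂ) - cubeIntegral f‖ := by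
        rw [← Complex.ofReal_sub, Complex.norm_real, Real.norm_eq_abs]
    _ ≤ ε + _ := (norm_sub_le_norm_sub_add_norm_sub _ (((b : ℂ) ^ m)⁻¹ * ∑ n, A n) _).trans
        (add_le_add hq hT)
    _ = _ := add_comm _ _

end InterlacedLattice

end

theorem mainTheorem3 (b : ℕ) [Fact b.Prime] (m s d : ℕ) (hm : 1 ≤ m) (hs : 1 ≤ s) (hd : 1 ≤ d)
    (p : Polynomial (ZMod b)) (hp : p.natDegree = m) (q : Fin (s * d) → Polynomial (ZMod b))
    (u : ℕ → ℝ) (hu_pos : ∀ j, 0 < u j) (hu_anti : Antitone u) :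
    Summable (fun k : ↥(InterlacedLattice.dualLattice m p q \ {0}) =>
        (b : ℝ) ^ (-InterlacedLattice.muTilde b s d (InterlacedLattice.shift b u) k)) ∧
      InterlacedLattice.worstCaseError u (InterlacedLattice.interlacedPoint m s d p q) ≤
        ENNReal.ofReal (∑' k : ↥(InterlacedLattice.dualLattice m p q \ {0}),
          (b : ℝ) ^ (-InterlacedLattice.muTilde b s d (InterlacedLattice.shift b u) k)) := by
  have : NeZero d := ⟨by omega⟩
  refine ⟨(InterlacedLattice.summable_rpow_neg_muTilde hu_pos hd).subtype _, ?_⟩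
  refine iSup₂_le fun f hf => ENNReal.ofReal_le_ofReal ?_
  exact InterlacedLattice.abs_qmcRule_sub_cubeIntegral_le p q hm hp hu_pos hf.1.1 hf.2
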